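/- Let $R_0$ be a commutative ring, $V$ a free $R_0$-module with basis $v_1,\dots,v_n$, $E=\Lambda V$ with its standard grading and the induced superfiltration ($\mathbb{Z}/2$-grading by parity, $F^pE=E^{\le p}$). Let $R=R_0[[x_1,\dots,x_n]]$ with $x_i$ dual to $v_i$, $\mathfrak m=(x_1,\dots,x_n)$, $\mathbf v=\sum_i x_iv_i\in\mathfrak m\otimes V$, and $E_R=R\otimes_{R_0}E$ with the superfiltration induced by its grading. A map between superfiltered modules is superfiltered of degree $r$ if it has degree $r$ modulo $2$ and sends $F^p$ into $F^{p+r}$ for all $p$; its leading term is the map induced on associated graded modules. Let $\mathcal A=(E,(\mu^k)_{k\ge2})$ be a superfiltered $A_\infty$-deformation of $E$: the $\mu^k:E[1]^{\otimes k}\to E[1]$ are superfiltered of degree $1$ and satisfy the $A_\infty$-relations $$\sum_{i,j}(-1)^{|a_1|+\dots+|a_i|-i}\mu^{k-j+1}(a_k,\dots,a_{i+j+1},\mu^j(a_{i+j},\dots,a_{i+1}),a_i,\dots,a_1)=0,$$ they are strictly unital with unit $1_E$, and their leading terms are $(a_2,a_1)\mapsto(-1)^{|a_1|}a_2\wedge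 a_1$ for $k=2$ and $0$ for $k\ge3$. Extending the $\mu^k$ $R$-multilinearly, let $\mathfrak P=\sum_{k\ge2}\mu^k(\mathbf v,\dots,\mathbf v)\in\mathfrak m^2\subset R$ be its disc potential. Let $\mathcal E$ be the module $E_R$ with the endomorphism $$\mathrm d_{\mathcal E}a=(-1)^{|a|}\sum_{l\ge1}\mu^{1+l}(a,\mathbf v,\dots,\mathbf v)$$ (the output of the localised mirror functor). Let $w_1,\dots,w_n\in\mathfrak m$ be any elements with $\sum_i x_iw_i=\mathfrak P$, and let $\mathcal E_0$ be $E_R$ with the endomorphism $\mathrm d_{\mathcal E_0}a=-(\mathbf v\wedge a+\sum_iw_i\,v_i^\vee\lrcorner a)$ (the stabilisation of $R_0$). Then $\mathcal E$ and $\mathcal E_0$ are filtered matrix factorisations of $\mathfrak P$ over $R$: $E_R$ is free of finite rank, and $\mathrm d_{\mathcal E}$, $\mathrm d_{\mathcal E_0}$ are $R$-linear, superfiltered of degree $1$, and square to $\mathfrak P\,\mathrm{id}$. Moreover: (1) There is an $R$-linear automorphism $i$ of $E_R$ which is superfiltered of degree $0$, has leading term $\mathrm{id}$ (so $i=\mathrm{id}_{E_R}+$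 lower-order terms), and is a cocycle in $\hom^0(\mathcal E,\mathcal E_0)$, that is, $\mathrm d_{\mathcal E_0}i=i\,\mathrm d_{\mathcal E}$. Its inverse is superfiltered of degree $0$ with leading term $\mathrm{id}$ and is a cocycle in $\hom^0(\mathcal E_0,\mathcal E)$. (2) Let $\mathcal B=\operatorname{end}(\mathcal E)$ and $\mathcal B_0=\operatorname{end}(\mathcal E_0)$, both with underlying $R$-algebra $\operatorname{End}_R(E_R)$ and with differentials $f\mapsto \mathrm d\circ f-(-1)^{|f|}f\circ\mathrm d$ for the respective $\mathrm d$. Conjugation $\psi(a)=i\,a\,i^{-1}$ is an isomorphism of unital dg-algebras $\mathcal B\to\mathcal B_0$ over $R$; both $\psi$ and $\psi^{-1}$ are superfiltered of degree $0$, and $\psi$ equals the identity of $\operatorname{End}_R(E_R)$ up to lower-order terms. (3) View a dg-algebra as an $A_\infty$-algebra by $\mu^1(a)=(-1)^{|a|}\mathrm da$, $\mu^2(a_2,a_1)=(-1)^{|a_1|}a_2a_1$, $\mu^k=0$ otherwise. Then $\Psi^1=\psi$, $\Psi^{k}=0$ for $k>1$ defines a strictly unital $A_\infty$-homomorphism $\mathcal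 B\to\mathcal B_0$ over $R$, superfiltered of degree $0$. -/

import Mathlib

open scoped TensorProduct DirectSum

universe u v

noncomputable section

namespace SuperMF

/-! ### Superfiltered modules -/

/-- A superfiltration on a module: a `ℤ/2`-grading `X = G 0 ⊕ G 1` and an increasing
`ℤ`-filtration `F` which is compatible with the grading, in the sense that each `F p` is the sum
of its even and odd parts and that `F (p + 1) ∩ X^p = F p ∩ X^p`, where the exponent of `X^p` is
read modulo `2`. -/
structure Superfiltration (R X : Type*) [CommRing R] [AddCommGroup X] [Module R X] where
  G : ZMod 2 → Submodule R X
  F : ℤ → Submodule R X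
  isCompl : IsCompl (G 0) (G 1)
  mono : Monotone F
  F_eq : ∀ p, F p = (F p ⊓ G 0) ⊔ (F p ⊓ G 1)
  jump : ∀ p : ℤ, F (p + 1) ⊓ G (p : ZMod 2) = F p ⊓ G (p : ZMod 2)

namespace Superfiltration

section Basic

variable {R X Y : Type*} [CommRing R] [AddCommGroup X] [Module R X] [AddCommGroup Y] [Module R Y]

/-- The projection onto the part of parity `i`. -/
def proj (S : Superfiltration R X) (i : ZMod 2) : X →ₗ[R] X :=
  if i = 0 then Submodule.projection (S.G 0) (S.G 1) S.isCompl
  else Submodule.projection (S.G 1) (S.G 0) S.isCompl.symm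

/-- The map `x ↦ (-1)^|x| x`. -/
def sign (S : Superfiltration R X) : X →ₗ[R] X := S.proj 0 - S.proj 1

theorem proj_mem (S : Superfiltration R X) (i : ZMod 2) (x : X) : S.proj i x ∈ S.G i := by
  fin_cases i
  · exact Submodule.projection_apply_mem S.isCompl x
  · exact Submodule.projection_apply_mem S.isCompl.symm x

theorem proj_add (S : Superfiltration R X) (x : X) : S.proj 0 x + S.proj 1 x = x := by
  have := Submodule.projection_add_projection_eq_self S.isCompl x
  simpa [proj] using this

theorem disjoint (S : Superfiltration R X) {i j : ZMod 2} (h : i ≠ j) {x : X}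
    (hi : x ∈ S.G i) (hj : x ∈ S.G j) : x = 0 := by
  have key : x ∈ S.G 0 ⊓ S.G 1 := by
    fin_cases i <;> fin_cases j <;> first | exact absurd rfl h | exact ⟨hi, hj⟩ | exact ⟨hj, hi⟩
  rw [S.isCompl.inf_eq_bot] at key
  exact key

theorem proj_of_mem (S : Superfiltration R X) {i : ZMod 2} {x : X} (h : x ∈ S.G i) :
    S.proj i x = x := by
  have h1 := S.proj_add x
  have key : S.proj (i + 1) x = 0 := by
    refine S.disjoint (i := i) (j := i + 1) (by simp) ?_ (S.proj_mem _ _)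
    have : S.proj (i + 1) x = x - S.proj i x := by
      fin_cases i
      · exact eq_sub_of_add_eq' h1
      · exact eq_sub_of_add_eq h1
    rw [this]
    exact sub_mem h (S.proj_mem _ _)
  fin_cases i
  · have h2 : S.proj 1 x = 0 := key
    rw [h2, add_zero] at h1
    exact h1
  · have h2 : S.proj 0 x = 0 := key
    rw [h2, zero_add] at h1
    exact h1

theorem proj_of_mem_ne (S : Superfiltration R X) {i j : ZMod 2} (hij : i ≠ j) {x : X}
    (h : x ∈ S.G i) : S.proj j x = 0 := by
  have h1 := S.proj_add x
  have h2 := S.proj_of_mem h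
  fin_cases i <;> fin_cases j <;> first
    | exact absurd rfl hij
    | (change S.proj 0 x = x at h2; rw [h2] at h1; exact left_eq_add.mp h1.symm)
    | (change S.proj 1 x = x at h2; rw [h2] at h1; exact right_eq_add.mp h1.symm)

theorem sign_of_mem (S : Superfiltration R X) {i : ℕ} {x : X} (h : x ∈ S.G (i : ZMod 2)) :
    S.sign x = (-1 : ℤ) ^ i • x := by
  rcases Nat.even_or_odd i with hi | hi
  · have e : (i : ZMod 2) = 0 := (ZMod.natCast_eq_zero_iff_even).2 hi
    rw [e] at h
    simp [sign, S.proj_of_mem h, S.proj_of_mem_ne zero_ne_one h, hi.neg_one_pow]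
  · have e : (i : ZMod 2) = 1 := (ZMod.natCast_eq_one_iff_odd).2 hi
    rw [e] at h
    simp [sign, S.proj_of_mem h, S.proj_of_mem_ne one_ne_zero h, hi.neg_one_pow]

theorem proj_mem_F (S : Superfiltration R X) {p : ℤ} {x : X} (h : x ∈ S.F p) (i : ZMod 2) :
    S.proj i x ∈ S.F p := by
  rw [S.F_eq p] at h
  obtain ⟨y, hy, z, hz, rfl⟩ := Submodule.mem_sup.1 h
  rw [map_add]
  fin_cases i
  · change S.proj 0 y + S.proj 0 z ∈ S.F p
    rw [S.proj_of_mem hy.2, S.proj_of_mem_ne one_ne_zero hz.2, add_zero]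
    exact hy.1
  · change S.proj 1 y + S.proj 1 z ∈ S.F p
    rw [S.proj_of_mem hz.2, S.proj_of_mem_ne zero_ne_one hy.2, zero_add]
    exact hz.1

theorem proj_add_shift (S : Superfiltration R X) (i : ZMod 2) (x : X) :
    S.proj i x + S.proj (i + 1) x = x := by
  fin_cases i
  · exact S.proj_add x
  · exact (add_comm _ _).trans (S.proj_add x)

/-- The part of parity `i` of a linear map. -/
def homPart (S : Superfiltration R X) (S' : Superfiltration R Y) (f : X →ₗ[R] Y) (i : ZMod 2) :
    X →ₗ[R] Y :=
  S'.proj i ∘ₗ f ∘ₗ S.proj 0 + S'.proj (1 + i) ∘ₗ f ∘ₗ S.proj 1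

theorem homPart_add (S : Superfiltration R X) (S' : Superfiltration R Y) (f : X →ₗ[R] Y) :
    S.homPart S' f 0 + S.homPart S' f 1 = f := by
  ext x
  have e : (1 + 1 : ZMod 2) = 0 := rfl
  have h0 := S'.proj_add (f (S.proj 0 x))
  have h1 := S'.proj_add (f (S.proj 1 x))
  have h2 := congrArg f (S.proj_add x)
  rw [map_add] at h2
  simp only [homPart, LinearMap.add_apply, LinearMap.comp_apply, add_zero, e]
  rw [← h2]
  refine Eq.trans ?_ (congrArg₂ (· + ·) h0 h1)
  abel

theorem homPart_shift (S : Superfiltration R X) (S' : Superfiltration R Y) (f : X →ₗ[R] Y)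
    (i j : ZMod 2) (x : X) (hx : x ∈ S.G j) : S.homPart S' f i x ∈ S'.G (j + i) := by
  fin_cases j
  · change x ∈ S.G 0 at hx
    change _ ∈ S'.G (0 + i)
    simp only [homPart, LinearMap.add_apply, LinearMap.comp_apply, S.proj_of_mem hx,
      S.proj_of_mem_ne zero_ne_one hx, map_zero, add_zero, zero_add]
    exact S'.proj_mem _ _
  · change x ∈ S.G 1 at hx
    change _ ∈ S'.G (1 + i)
    simp only [homPart, LinearMap.add_apply, LinearMap.comp_apply, S.proj_of_mem hx,
      S.proj_of_mem_ne one_ne_zero hx, map_zero, zero_add]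
    exact S'.proj_mem _ _

theorem homPart_filtered (S : Superfiltration R X) (S' : Superfiltration R Y) {f : X →ₗ[R] Y}
    {p : ℤ} (hf : ∀ q, ∀ x ∈ S.F q, f x ∈ S'.F (q + p)) (i : ZMod 2) (q : ℤ) (x : X)
    (hx : x ∈ S.F q) : S.homPart S' f i x ∈ S'.F (q + p) :=
  add_mem (S'.proj_mem_F (hf q _ (S.proj_mem_F hx 0)) _)
    (S'.proj_mem_F (hf q _ (S.proj_mem_F hx 1)) _)

/-- The superfiltration on `Hom_R(X, Y)`: the part of parity `i` consists of the maps which shift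
parity by `i`, and the `p`-th filtered piece of the maps which send `F^q X` to `F^{q+p} Y` for
all `q`. -/
def hom (S : Superfiltration R X) (S' : Superfiltration R Y) : Superfiltration R (X →ₗ[R] Y) where
  G i :=
    { carrier := {f | ∀ j, ∀ x ∈ S.G j, f x ∈ S'.G (j + i)}
      add_mem' := fun hf hg j x hx => add_mem (hf j x hx) (hg j x hx)
      zero_mem' := fun _ _ _ => zero_mem _
      smul_mem' := fun c _ hf j x hx => Submodule.smul_mem _ c (hf j x hx) }
  F p :=
    { carrier := {f | ∀ q, ∀ x ∈ S.F q, f x ∈ S'.F (q + p)}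
      add_mem' := fun hf hg j x hx => add_mem (hf j x hx) (hg j x hx)
      zero_mem' := fun _ _ _ => zero_mem _
      smul_mem' := fun c _ hf j x hx => Submodule.smul_mem _ c (hf j x hx) }
  isCompl := by
    refine IsCompl.of_eq ?_ ?_
    · refine (Submodule.eq_bot_iff _).2 fun f hf => LinearMap.ext fun x => ?_
      have key : ∀ j, f (S.proj j x) = 0 := fun j =>
        S'.disjoint (i := j + 0) (j := j + 1) (by simp) (hf.1 j _ (S.proj_mem j x))
          (hf.2 j _ (S.proj_mem j x))
      rw [← S.proj_add x, map_add, key, key, add_zero, LinearMap.zero_apply]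
    · refine (Submodule.eq_top_iff').2 fun f => ?_
      rw [← S.homPart_add S' f]
      exact Submodule.add_mem_sup (S.homPart_shift S' f 0) (S.homPart_shift S' f 1)
  mono := fun p p' h f hf q x hx => S'.mono (by lia) (hf q x hx)
  F_eq := by
    intro p
    refine le_antisymm (fun f hf => ?_) (sup_le inf_le_left inf_le_left)
    rw [← S.homPart_add S' f]
    exact Submodule.add_mem_sup
      ⟨S.homPart_filtered S' hf 0, S.homPart_shift S' f 0⟩
      ⟨S.homPart_filtered S' hf 1, S.homPart_shift S' f 1⟩
  jump := by
    intro p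
    refine le_antisymm (fun f hf => ⟨fun q x hx => ?_, hf.2⟩)
      (fun f hf => ⟨fun q x hx => S'.mono (by lia) (hf.1 q x hx), hf.2⟩)
    have h1 : f (S.proj (q : ZMod 2) x) ∈ S'.F (q + p) := by
      have hm := S.proj_mem_F hx (q : ZMod 2)
      have := hf.1 q _ hm
      have h2 := hf.2 _ _ (S.proj_mem (q : ZMod 2) x)
      rw [← add_assoc] at this
      rw [← Int.cast_add] at h2
      exact (S'.jump (q + p)).le.trans inf_le_left ⟨this, h2⟩
    have h2 : f (S.proj ((q : ZMod 2) + 1) x) ∈ S'.F (q + p) := by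
      have e : (q : ZMod 2) + 1 = ((q - 1 : ℤ) : ZMod 2) := by
        push_cast
        rw [sub_eq_add_neg]
        congr 1
      have hm := S.proj_mem_F hx ((q : ZMod 2) + 1)
      have hg := S.proj_mem ((q : ZMod 2) + 1) x
      have hj := S.jump (q - 1)
      rw [sub_add_cancel, ← e] at hj
      have hm' : S.proj ((q : ZMod 2) + 1) x ∈ S.F (q - 1) :=
        hj.le.trans inf_le_left ⟨hm, hg⟩
      have := hf.1 _ _ hm'
      rwa [show q - 1 + (p + 1) = q + p by ring] at this
    rw [← S.proj_add_shift (q : ZMod 2) x, map_add]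
    exact add_mem h1 h2

/-- A linear map is superfiltered of degree `r` if it has degree `r` modulo `2` and sends `F^p` to
`F^{p+r}`. -/
def IsSuperfiltered (S : Superfiltration R X) (S' : Superfiltration R Y) (r : ℤ)
    (f : X →ₗ[R] Y) : Prop :=
  f ∈ (S.hom S').G (r : ZMod 2) ∧ f ∈ (S.hom S').F r

/-- Two maps which are superfiltered of degree `r` have the same leading term, i.e. induce the
same map `gr X → gr Y` of degree `r`, if their difference sends `F^p` to `F^{p+r-1}`. -/
def SameLeadingTerm (S : Superfiltration R X) (S' : Superfiltration R Y) (r : ℤ)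
    (f g : X →ₗ[R] Y) : Prop :=
  f - g ∈ (S.hom S').F (r - 1)

end Basic

section Graded

variable {R X : Type*} [CommRing R] [AddCommGroup X] [Module R X]

/-- The homogeneous component of degree `n`, as an endomorphism of `X`. -/
def component (𝒜 : ℕ → Submodule R X) [DirectSum.Decomposition 𝒜] (n : ℕ) : X →ₗ[R] X :=
  (𝒜 n).subtype ∘ₗ DirectSum.component R ℕ (fun n => 𝒜 n) n ∘ₗ
    (DirectSum.decomposeLinearEquiv 𝒜).toLinearMap

theorem component_apply (𝒜 : ℕ → Submodule R X) [DirectSum.Decomposition 𝒜] (n : ℕ) (x : X) :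
    component 𝒜 n x = (DirectSum.decompose 𝒜 x n : X) := rfl

theorem component_ext (𝒜 : ℕ → Submodule R X) [DirectSum.Decomposition 𝒜] {x y : X}
    (h : ∀ n, component 𝒜 n x = component 𝒜 n y) : x = y := by
  apply (DirectSum.decompose 𝒜).injective
  exact DFinsupp.ext fun n => Subtype.ext (h n)

/-- The sum of the homogeneous components of degree congruent to `i` modulo `2`. -/
def parityPart (𝒜 : ℕ → Submodule R X) [DirectSum.Decomposition 𝒜] (i : ZMod 2) (x : X) : X :=
  (DirectSum.decompose 𝒜).symm
    (DFinsupp.filter (fun n : ℕ => (n : ZMod 2) = i) (DirectSum.decompose 𝒜 x))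

theorem component_parityPart (𝒜 : ℕ → Submodule R X) [DirectSum.Decomposition 𝒜] (i : ZMod 2)
    (x : X) (n : ℕ) :
    component 𝒜 n (parityPart 𝒜 i x) = if (n : ZMod 2) = i then component 𝒜 n x else 0 := by
  rw [component_apply, parityPart, Equiv.apply_symm_apply]
  erw [DFinsupp.filter_apply]
  split_ifs <;> rfl

theorem parityPart_add (𝒜 : ℕ → Submodule R X) [DirectSum.Decomposition 𝒜] (x : X) :
    parityPart 𝒜 0 x + parityPart 𝒜 1 x = x := by
  refine component_ext 𝒜 fun n => ?_
  rw [map_add, component_parityPart, component_parityPart]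
  generalize (n : ZMod 2) = m
  fin_cases m
  · exact add_zero _
  · exact zero_add _

/-- The superfiltration induced by a grading `X = ⨁ 𝒜 n` (a `ℤ`-grading concentrated in
non-negative degrees): the part of parity `i` consists of the elements whose homogeneous components
of degree not congruent to `i` modulo `2` vanish, and `F p` of those whose components of degree
greater than `p` vanish. -/
def ofGrading (𝒜 : ℕ → Submodule R X) [DirectSum.Decomposition 𝒜] : Superfiltration R X where
  G i := ⨅ (n : ℕ) (_ : (n : ZMod 2) ≠ i), LinearMap.ker (component 𝒜 n)
  F p := ⨅ (n : ℕ) (_ : p < n), LinearMap.ker (component 𝒜 n)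
  isCompl := by
    refine IsCompl.of_eq ?_ ?_
    · refine (Submodule.eq_bot_iff _).2 fun x hx => component_ext 𝒜 fun n => ?_
      simp only [Submodule.mem_inf, Submodule.mem_iInf, LinearMap.mem_ker] at hx
      rw [map_zero]
      by_cases h : (n : ZMod 2) = 0
      · exact hx.2 n (by rw [h]; exact zero_ne_one)
      · exact hx.1 n h
    · refine (Submodule.eq_top_iff').2 fun x => ?_
      rw [← parityPart_add 𝒜 x]
      refine Submodule.add_mem_sup ?_ ?_ <;>
        · simp only [Submodule.mem_iInf, LinearMap.mem_ker]
          intro n hn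
          rw [component_parityPart, if_neg hn]
  mono := by
    intro p p' h x hx
    simp only [Submodule.mem_iInf, LinearMap.mem_ker] at hx ⊢
    exact fun n hn => hx n (by lia)
  F_eq := by
    intro p
    refine le_antisymm (fun x hx => ?_) (sup_le inf_le_left inf_le_left)
    rw [← parityPart_add 𝒜 x]
    simp only [Submodule.mem_iInf, LinearMap.mem_ker] at hx
    refine Submodule.add_mem_sup ?_ ?_ <;>
      · simp only [Submodule.mem_inf, Submodule.mem_iInf, LinearMap.mem_ker]
        refine ⟨fun n hn => ?_, fun n hn => ?_⟩
        · rw [component_parityPart, hx n hn, ite_self]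
        · rw [component_parityPart, if_neg hn]
  jump := by
    intro p
    ext x
    simp only [Submodule.mem_inf, Submodule.mem_iInf, LinearMap.mem_ker]
    refine ⟨fun h => ⟨fun n hn => ?_, h.2⟩, fun h => ⟨fun n hn => h.1 n (by lia), h.2⟩⟩
    by_cases hp : (n : ℤ) = p + 1
    · refine h.2 n ?_
      have : (n : ZMod 2) = (p : ZMod 2) + 1 := by exact_mod_cast congrArg (Int.cast (R := ZMod 2)) hp
      rw [this]
      simp
    · exact h.1 n (by lia)

end Graded

end Superfiltration

open Superfiltration

/-! ### `A_∞`-algebras and `A_∞`-homomorphisms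

A `k`-ary operation is written with its inputs in the order `(a_k, …, a_1)`. In the formal
development input `a_{t+1}` has index `t : Fin k`, so that index `0` is the rightmost input. -/

section AInfinity

variable {R X Y Z : Type*} [CommRing R] [AddCommGroup X] [Module R X] [AddCommGroup Y] [Module R Y]
  [AddCommGroup Z] [Module R Z]

/-- A sequence of multilinear operations `f^k(a_k, …, a_1)`. -/
abbrev Ops (R X Y : Type*) [CommRing R] [AddCommGroup X] [Module R X] [AddCommGroup Y]
    [Module R Y] : Type _ :=
  ∀ k : ℕ, MultilinearMap R (fun _ : Fin k => X) Y

/-- `f : X[1]^{⊗k} → Y[1]` has degree `r` modulo `2`; unshifted, its output has degree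
`∑ (|a_t| - 1) + 1 + r`. -/
def ShiftedDegree (S : Superfiltration R X) (S' : Superfiltration R Y) (r : ℤ) {k : ℕ}
    (f : MultilinearMap R (fun _ : Fin k => X) Y) : Prop :=
  ∀ (d : Fin k → ℤ) (a : Fin k → X), (∀ t, a t ∈ S.G (d t : ZMod 2)) →
    f a ∈ S'.G ((∑ t, (d t - 1) + 1 + r : ℤ) : ZMod 2)

/-- `f : X[1]^{⊗k} → Y[1]` raises filtration level by at most `r`, the filtration on `X[1]`
being `F^p(X[1]) = F^{p+1} X`. -/
def ShiftedFiltered (S : Superfiltration R X) (S' : Superfiltration R Y) (r : ℤ) {k : ℕ}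
    (f : MultilinearMap R (fun _ : Fin k => X) Y) : Prop :=
  ∀ (p : Fin k → ℤ) (a : Fin k → X), (∀ t, a t ∈ S.F (p t)) →
    f a ∈ S'.F (∑ t, (p t - 1) + 1 + r)

/-- For inputs `a_{t+1} = a t` of degree `d t`, the sum over `i, j` of
`(-1)^{✠_i} f^{k-j+1}(a_k, …, a_{i+j+1}, μ^j(a_{i+j}, …, a_{i+1}), a_i, …, a_1)`, where
`✠_i = |a_1| + … + |a_i| - i`. -/
def insertionSum (μ : Ops R X X) (f : Ops R X Y) (k : ℕ) (d : ℕ → ℕ) (a : ℕ → X) : Y :=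
  ∑ j ∈ Finset.Icc 1 k, ∑ i ∈ Finset.range (k - j + 1),
    (-1 : ℤ) ^ (∑ t ∈ Finset.range i, (d t + 1)) •
      f (k - j + 1) (fun t =>
        if (t : ℕ) < i then a t
        else if (t : ℕ) = i then μ j (fun s => a (i + s))
        else a (t + j - 1))

/-- The sum over `r` and `s_1 + … + s_r = k` of
`μ^r(f^{s_r}(a_k, …, a_{k-s_r+1}), …, f^{s_1}(a_{s_1}, …, a_1))`. -/
def compositionSum (μ : Ops R Y Y) (f : Ops R X Y) (k : ℕ) (a : ℕ → X) : Y :=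
  ∑ c : Composition k, μ c.length (fun r => f (c.blocksFun r) (fun s => a (c.embedding r s)))

/-- A strictly unital superfiltered `A_∞`-algebra structure (without curvature) on `X`, with
unit `e`. -/
structure IsAInfinityAlgebra (S : Superfiltration R X) (μ : Ops R X X) (e : X) : Prop where
  curvature : μ 0 = 0
  degree : ∀ k, ShiftedDegree S S 1 (μ k)
  filtered : ∀ k, ShiftedFiltered S S 1 (μ k)
  relations : ∀ (k : ℕ) (d : ℕ → ℕ) (a : ℕ → X), (∀ t, a t ∈ S.G (d t : ZMod 2)) →
    insertionSum μ μ k d a = 0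
  unit_mem : e ∈ S.G 0 ⊓ S.F 0
  unit_right : ∀ x, μ 2 ![e, x] = x
  unit_left : ∀ x, μ 2 ![x, e] = S.sign x
  unit_zero : ∀ k, k ≠ 2 → ∀ (a : Fin k → X) (t : Fin k), a t = e → μ k a = 0

/-- A strictly unital `A_∞`-homomorphism `(X, μ) → (Y, μ')` which is superfiltered of
degree `0`. -/
structure IsAInfinityHom (S : Superfiltration R X) (S' : Superfiltration R Y) (μ : Ops R X X)
    (μ' : Ops R Y Y) (e : X) (e' : Y) (f : Ops R X Y) : Prop where
  zero : f 0 = 0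
  degree : ∀ k, ShiftedDegree S S' 0 (f k)
  filtered : ∀ k, ShiftedFiltered S S' 0 (f k)
  relations : ∀ (k : ℕ) (d : ℕ → ℕ) (a : ℕ → X), (∀ t, a t ∈ S.G (d t : ZMod 2)) →
    insertionSum μ f k d a = compositionSum μ' f k a
  unit : f 1 ![e] = e'
  unit_zero : ∀ k, k ≠ 1 → ∀ (a : Fin k → X) (t : Fin k), a t = e → f k a = 0

/-- The operations with unary part `f` and all other components zero. -/
def unaryOps (f : X →ₗ[R] Y) : Ops R X Y
  | 1 => MultilinearMap.ofSubsingleton R X Y 0 f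
  | _ => 0

/-- The binary operation `(a_2, a_1) ↦ (-1)^{|a_1|} a_2 a_1` built from a bilinear product. -/
def signedMul (S : Superfiltration R X) (mul : X →ₗ[R] X →ₗ[R] X) :
    MultilinearMap R (fun _ : Fin 2 => X) X where
  toFun a := mul (a 1) (S.sign (a 0))
  map_update_add' a t x y := by
    fin_cases t <;> simp
  map_update_smul' a t c x := by
    fin_cases t <;> simp

/-- A dg-algebra `X` with product `mul` and differential `d`, seen as an `A_∞`-algebra:
`μ^1(a) = (-1)^{|a|} d a`, `μ^2(a_2, a_1) = (-1)^{|a_1|} a_2 a_1`, and all other operations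
zero. -/
def dgOps (S : Superfiltration R X) (mul : X →ₗ[R] X →ₗ[R] X) (d : X →ₗ[R] X) : Ops R X X
  | 1 => MultilinearMap.ofSubsingleton R X X 0 (d ∘ₗ S.sign)
  | 2 => signedMul S mul
  | _ => 0

end AInfinity

/-! ### Filtered matrix factorisations -/

section MatrixFactorisation

variable {R X Y : Type*} [CommRing R] [AddCommGroup X] [Module R X] [AddCommGroup Y] [Module R Y]

/-- `(X, d)` is a filtered matrix factorisation of `w` over `R`. -/
structure IsFilteredMF (S : Superfiltration R X) (w : R) (d : X →ₗ[R] X) : Prop where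
  free : Module.Free R X
  finite : Module.Finite R X
  superfiltered : S.IsSuperfiltered S 1 d
  square : d ∘ₗ d = w • LinearMap.id

/-- The differential `f ↦ d_Y ∘ f - (-1)^{|f|} f ∘ d_X` on the morphism space from `(X, d_X)` to
`(Y, d_Y)`. -/
def homDiff (S : Superfiltration R X) (S' : Superfiltration R Y) (dX : X →ₗ[R] X)
    (dY : Y →ₗ[R] Y) : (X →ₗ[R] Y) →ₗ[R] (X →ₗ[R] Y) :=
  LinearMap.llcomp R X Y Y dY - LinearMap.lcomp R Y dX ∘ₗ (S.hom S').sign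

theorem homDiff_of_mem (S : Superfiltration R X) (S' : Superfiltration R Y) (dX : X →ₗ[R] X)
    (dY : Y →ₗ[R] Y) {i : ℕ} {f : X →ₗ[R] Y} (hf : f ∈ (S.hom S').G (i : ZMod 2)) :
    homDiff S S' dX dY f = dY ∘ₗ f - (-1 : ℤ) ^ i • (f ∘ₗ dX) := by
  ext x
  simp [homDiff, sign_of_mem _ hf]

end MatrixFactorisation

/-! ### Superfiltered deformations of the exterior algebra -/

section Deformation

variable (R₀ : Type u) [CommRing R₀] (V : Type v) [AddCommGroup V] [Module R₀ V]

/-- The standard superfiltration on the exterior algebra `E = ΛV`. -/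
def extSF : Superfiltration R₀ (ExteriorAlgebra R₀ V) := ofGrading (fun n : ℕ => ⋀[R₀]^n V)

/-- The operations of the dg-algebra of endomorphisms of `(X, d)`, whose product is
composition. -/
def endOps {R X : Type*} [CommRing R] [AddCommGroup X] [Module R X] (S : Superfiltration R X)
    (d : X →ₗ[R] X) : Ops R (X →ₗ[R] X) (X →ₗ[R] X) :=
  dgOps (S.hom S) (LinearMap.llcomp R X X X) (homDiff S S d d)

/-- A superfiltered `A_∞`-deformation of `E = ΛV`: strictly unital superfiltered operations
`μ^k`, `k ≥ 2`, satisfying the `A_∞`-relations, whose leading terms are those of the formal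
`A_∞`-structure on `E` (with `μ^2(a_2, a_1) = (-1)^{|a_1|} a_2 ∧ a_1`, all others zero). -/
structure SuperfilteredDeformation where
  μ : Ops R₀ (ExteriorAlgebra R₀ V) (ExteriorAlgebra R₀ V)
  isAInfinity : IsAInfinityAlgebra (extSF R₀ V) μ 1
  minimal : μ 1 = 0
  leading : ∀ k, ShiftedFiltered (extSF R₀ V) (extSF R₀ V) 0 
    (μ k - dgOps (extSF R₀ V) (LinearMap.mul R₀ (ExteriorAlgebra R₀ V)) 0 k)

end Deformation

section Mirror

variable {R₀ : Type u} [CommRing R₀] {V : Type v} [AddCommGroup V] [Module R₀ V] {n : ℕ}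

variable (R₀) in
/-- The ring `R = R₀⟦V⟧` in the coordinates `x_1, …, x_n` given by a basis of `V`. -/
abbrev FormalRing (n : ℕ) : Type u := MvPowerSeries (Fin n) R₀

variable (R₀ V) in
/-- The `R`-module `E_R = R ⊗ E`. -/
abbrev ExtR (n : ℕ) : Type (max u v) := FormalRing R₀ n ⊗[R₀] ExteriorAlgebra R₀ V

variable (R₀ V) in
/-- The standard superfiltration on `E_R`, induced by the grading with pieces `R ⊗ Λ^d V`. -/
def extRSF (n : ℕ) : Superfiltration (FormalRing R₀ n) (ExtR R₀ V n) :=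
  ofGrading (fun d : ℕ => (⋀[R₀]^d V).baseChange (FormalRing R₀ n))

variable (R₀ V) in
/-- The superfiltration on `End_R(E_R)`. -/
abbrev endSF (n : ℕ) : Superfiltration (FormalRing R₀ n) (Module.End (FormalRing R₀ n) (ExtR R₀ V n)) :=
  (extRSF R₀ V n).hom (extRSF R₀ V n)

/-- The element of `R ⊗ E` given by the power series `∑_m x^m c_m` with coefficients in the finite
free module `E`. -/
def ofCoeffs (b : Module.Basis (Fin n) R₀ V) (c : (Fin n →₀ ℕ) → ExteriorAlgebra R₀ V) :
    ExtR R₀ V n :=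
  ∑ s : Finset (Fin n),
    (show FormalRing R₀ n from fun m => b.ExteriorAlgebra.repr (c m) s) ⊗ₜ b.ExteriorAlgebra s

/-- The coefficient of `x^m` of an element of `R ⊗ E`. -/
def coeffE (m : Fin n →₀ ℕ) : ExtR R₀ V n →ₗ[R₀] ExteriorAlgebra R₀ V :=
  (TensorProduct.lid R₀ _).toLinearMap ∘ₗ (MvPowerSeries.coeff m).rTensor _

theorem coeffE_ofCoeffs (b : Module.Basis (Fin n) R₀ V)
    (c : (Fin n →₀ ℕ) → ExteriorAlgebra R₀ V) (m : Fin n →₀ ℕ) :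
    coeffE m (ofCoeffs b c) = c m := by
  rw [ofCoeffs, map_sum]
  conv_rhs => rw [← b.ExteriorAlgebra.sum_repr (c m)]
  rfl

theorem ofCoeffs_add (b : Module.Basis (Fin n) R₀ V)
    (c c' : (Fin n →₀ ℕ) → ExteriorAlgebra R₀ V) :
    ofCoeffs b (fun m => c m + c' m) = ofCoeffs b c + ofCoeffs b c' := by
  rw [ofCoeffs, ofCoeffs, ofCoeffs, ← Finset.sum_add_distrib]
  refine Finset.sum_congr rfl fun s _ => ?_
  rw [← TensorProduct.add_tmul]
  congr 1
  funext m
  exact congrArg (fun z => z s) (map_add b.ExteriorAlgebra.repr (c m) (c' m))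

theorem ofCoeffs_smul (b : Module.Basis (Fin n) R₀ V) (r : R₀)
    (c : (Fin n →₀ ℕ) → ExteriorAlgebra R₀ V) :
    ofCoeffs b (fun m => r • c m) = r • ofCoeffs b c := by
  rw [ofCoeffs, ofCoeffs, Finset.smul_sum]
  refine Finset.sum_congr rfl fun s _ => ?_
  rw [TensorProduct.smul_tmul']
  congr 1
  funext m
  exact congrArg (fun z => z s) (map_smul b.ExteriorAlgebra.repr r (c m))

/-- The words `(i_1, …, i_l)` of length `l = |m|` with `x_{i_1} ⋯ x_{i_l} = x^m`. -/
def words (m : Fin n →₀ ℕ) : Finset (Fin m.degree → Fin n) :=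
  {i | ∑ t, Finsupp.single (i t) 1 = m}

/-- The operation `a ↦ μ^1_{0,v}(a) = ∑_{l ≥ 0} μ^{1+l}(a, v, …, v)` on `E_R`, where
`v = ∑ x_i v_i` and the `μ^k` are extended `R`-multilinearly. For `a` in `E` the coefficient of
`x^m` is the sum of `μ^{1+l}(a, v_{i_l}, …, v_{i_1})` over all words with
`x_{i_1} ⋯ x_{i_l} = x^m`. -/
def insertV (b : Module.Basis (Fin n) R₀ V) (A : SuperfilteredDeformation R₀ V) :
    ExtR R₀ V n →ₗ[FormalRing R₀ n] ExtR R₀ V n :=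
  LinearMap.liftBaseChange (FormalRing R₀ n)
    { toFun := fun a => ofCoeffs b fun m => ∑ i ∈ words m,
        A.μ (m.degree + 1) (Fin.snoc (fun t => ExteriorAlgebra.ι R₀ (b (i t))) a)
      map_add' := fun a a' => by
        rw [← ofCoeffs_add]
        simp only [← Finset.sum_add_distrib, MultilinearMap.snoc_add]
      map_smul' := fun r a => by
        rw [RingHom.id_apply, ← ofCoeffs_smul]
        simp only [Finset.smul_sum, MultilinearMap.snoc_smul] }

/-- The squifferential `a ↦ (-1)^{|a|} μ^1_{0,v}(a)` of the matrix factorisation produced by the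
localised mirror functor. -/
def mirrorD (b : Module.Basis (Fin n) R₀ V) (A : SuperfilteredDeformation R₀ V) :
    ExtR R₀ V n →ₗ[FormalRing R₀ n] ExtR R₀ V n :=
  insertV b A ∘ₗ (extRSF R₀ V n).sign

/-- The disc potential `∑_k μ^k(v, …, v)`. The coefficient of `x^m` is the sum of
`μ^k(v_{i_k}, …, v_{i_1})` over all words with `x_{i_1} ⋯ x_{i_k} = x^m`; it lies in `E^0 = R₀`
and is read off as its component in degree `0`. -/
def discPotential (b : Module.Basis (Fin n) R₀ V) (A : SuperfilteredDeformation R₀ V) :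
    FormalRing R₀ n :=
  fun m => ExteriorAlgebra.algebraMapInv
    (∑ i ∈ words m, A.μ m.degree (fun t => ExteriorAlgebra.ι R₀ (b (i t))))

/-- The canonical element `v = ∑ x_i v_i` of `𝔪 ⊗ V`, seen in `E_R`. -/
def canonicalV (b : Module.Basis (Fin n) R₀ V) : ExtR R₀ V n :=
  ∑ i, MvPowerSeries.X i ⊗ₜ ExteriorAlgebra.ι R₀ (b i)

/-- `w = ∑ w_i v_i^∨` is an element of `𝔪 ⊗ V^∨` whose contraction with `v` is `P`. -/
def IsLift (P : FormalRing R₀ n) (w : Fin n → FormalRing R₀ n) : Prop :=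
  (∀ i, w i ∈ RingHom.ker (MvPowerSeries.constantCoeff (σ := Fin n) (R := R₀))) ∧
    ∑ i, MvPowerSeries.X i * w i = P

/-- The squifferential `a ↦ -(v ∧ a + w ⌟ a)` of the stabilisation of `R₀`. -/
def koszulD (b : Module.Basis (Fin n) R₀ V) (w : Fin n → FormalRing R₀ n) :
    ExtR R₀ V n →ₗ[FormalRing R₀ n] ExtR R₀ V n :=
  -(LinearMap.mulLeft (FormalRing R₀ n) (canonicalV b) +
    ∑ i, w i • LinearMap.baseChange (FormalRing R₀ n)
      (CliffordAlgebra.contractLeft (Q := (0 : QuadraticForm R₀ V)) (b.coord i)))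

end Mirror

end SuperMF

end

open SuperMF

/-! Write K for left multiplication by the canonical element v. Both differentials have leading term
-K: the Koszul one is -(K + W), with W contraction by w, and the mirror one is -K + D. The
hypothesis on leading terms puts D in filtration degree 0. Since D is odd, the compatibility of
filtration and parity puts it in degree -1.

Both maps square to the potential. For the Koszul one this is the Clifford relation
(`clifford_mul_self`). For the mirror one it is the A∞-relation with inputs (a, v, …, v): the
potential is a multiple of the unit (`potentialCoeff_mem_F`), so strict unitality kills every
insertion of μ(v, …, v) except the one into μ^2 (`insertCoeff_insertCoeff`).

The cocycle i is obtained by correcting the identity. Let d' be the Koszul and d the mirror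
differential. The defect f = d' i - i d lowers the filtration by one and satisfies d' f + f d = 0.
The Koszul complex (E_R, K) is exact below the top degree, with a homotopy H
(`exists_koszul_homotopy`), and f takes values below the top degree. Adding h = H f to i therefore
removes the current leading part of f.

H divides by variables, so it is only R₀-linear. For this reason h is prescribed on a basis and
extended R-linearly, and the terms H f K and h K need not cancel. They do not improve the filtration
degree of the defect, but they do improve p - 2q, where p is the degree of the source and q that of
the target (`IsSkew`, `isSkew_lift_step`). This weight is bounded by n, so finitely many corrections
suffice (`exists_closed_lift`).

The resulting i is unipotent, hence invertible by a geometric series (`exists_unipotent_inverse`).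
The claims on endomorphism algebras follow by conjugating with i (`exists_conj_isomorphism`). -/

namespace SuperMF

/-! ### Superfiltrations tested on homogeneous bases; parity and filtration of composites. -/

namespace Superfiltration

section HomogeneousBasis

variable {R X Y Z ι : Type*} [CommRing R] [AddCommGroup X] [Module R X] [AddCommGroup Y]
  [Module R Y] [AddCommGroup Z] [Module R Z]

/-- A basis of homogeneous elements turns filtration and parity into vanishing conditions on
coordinates, which is how both are tested below. -/
theorem repr_component {𝒜 : ℕ → Submodule R X} [DirectSum.Decomposition 𝒜]
    (B : Module.Basis ι R X) {deg : ι → ℕ} (hB : ∀ s, B s ∈ 𝒜 (deg s)) (q : ℕ) (x : X) (s : ι) :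
    B.repr (component 𝒜 q x) s = if deg s = q then B.repr x s else 0 := by
  classical
  induction B.mem_span x using Submodule.span_induction with
  | zero => simp
  | add x y _ _ hx hy =>
    simp only [map_add, Finsupp.add_apply, hx, hy]
    split_ifs <;> simp
  | smul c x _ hx =>
    simp only [map_smul, Finsupp.smul_apply, hx]
    split_ifs <;> simp
  | mem x hx =>
    obtain ⟨t, rfl⟩ := hx
    rw [component_apply]
    by_cases h : deg t = q
    · subst h
      rw [DirectSum.decompose_of_mem_same _ (hB t), B.repr_self, Finsupp.single_apply]
      by_cases hst : t = s
      · subst hst; simp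
      · simp [hst]
    · rw [DirectSum.decompose_of_mem_ne _ (hB t) h, B.repr_self, Finsupp.single_apply]
      by_cases hst : t = s
      · subst hst; simp [h]
      · simp [hst]

theorem component_eq_zero_iff {𝒜 : ℕ → Submodule R X} [DirectSum.Decomposition 𝒜]
    (B : Module.Basis ι R X) {deg : ι → ℕ} (hB : ∀ s, B s ∈ 𝒜 (deg s)) (q : ℕ) (x : X) :
    component 𝒜 q x = 0 ↔ ∀ s, deg s = q → B.repr x s = 0 := by
  rw [← B.repr.map_eq_zero_iff, Finsupp.ext_iff]
  refine forall_congr' fun s => ?_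
  rw [repr_component B hB]
  simp

theorem mem_F_ofGrading {𝒜 : ℕ → Submodule R X} [DirectSum.Decomposition 𝒜]
    (B : Module.Basis ι R X) {deg : ι → ℕ} (hB : ∀ s, B s ∈ 𝒜 (deg s)) {p : ℤ} {x : X} :
    x ∈ (ofGrading 𝒜).F p ↔ ∀ s, p < deg s → B.repr x s = 0 := by
  simp only [ofGrading, Submodule.mem_iInf, LinearMap.mem_ker, component_eq_zero_iff B hB]
  exact ⟨fun h s hs => h _ hs s rfl, fun h q hq s hs => h s (hs ▸ hq)⟩

theorem mem_G_ofGrading {𝒜 : ℕ → Submodule R X} [DirectSum.Decomposition 𝒜]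
    (B : Module.Basis ι R X) {deg : ι → ℕ} (hB : ∀ s, B s ∈ 𝒜 (deg s)) {i : ZMod 2} {x : X} :
    x ∈ (ofGrading 𝒜).G i ↔ ∀ s, (deg s : ZMod 2) ≠ i → B.repr x s = 0 := by
  simp only [ofGrading, Submodule.mem_iInf, LinearMap.mem_ker, component_eq_zero_iff B hB]
  exact ⟨fun h s hs => h _ hs s rfl, fun h q hq s hs => h s (hs ▸ hq)⟩

theorem mem_F_of_mem_degree {𝒜 : ℕ → Submodule R X} [DirectSum.Decomposition 𝒜] {q : ℕ} {p : ℤ}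
    (hqp : (q : ℤ) ≤ p) {x : X} (hx : x ∈ 𝒜 q) : x ∈ (ofGrading 𝒜).F p := by
  simp only [ofGrading, Submodule.mem_iInf, LinearMap.mem_ker]
  intro n hn
  rw [component_apply, DirectSum.decompose_of_mem_ne _ hx (by lia)]

theorem mem_G_of_mem_degree {𝒜 : ℕ → Submodule R X} [DirectSum.Decomposition 𝒜] {q : ℕ}
    {i : ZMod 2} (hqi : (q : ZMod 2) = i) {x : X} (hx : x ∈ 𝒜 q) : x ∈ (ofGrading 𝒜).G i := by
  simp only [ofGrading, Submodule.mem_iInf, LinearMap.mem_ker]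
  intro n hn
  rw [component_apply, DirectSum.decompose_of_mem_ne _ hx]
  rintro rfl
  exact hn hqi

theorem comp_mem_F {S : Superfiltration R X} {S' : Superfiltration R Y} {S'' : Superfiltration R Z}
    {p q r : ℤ} (hr : p + q ≤ r) {g : Y →ₗ[R] Z} {f : X →ₗ[R] Y} (hg : g ∈ (S'.hom S'').F p)
    (hf : f ∈ (S.hom S').F q) : g ∘ₗ f ∈ (S.hom S'').F r :=
  fun m x hx => S''.mono (by lia) (hg _ _ (hf m x hx))

theorem comp_mem_G {S : Superfiltration R X} {S' : Superfiltration R Y} {S'' : Superfiltration R Z}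
    {i j k : ZMod 2} (hk : i + j = k) {g : Y →ₗ[R] Z} {f : X →ₗ[R] Y} (hg : g ∈ (S'.hom S'').G i)
    (hf : f ∈ (S.hom S').G j) : g ∘ₗ f ∈ (S.hom S'').G k := fun m x hx => by
  rw [← hk, add_comm i, ← add_assoc]
  exact hg _ _ (hf m x hx)

theorem id_mem_F (S : Superfiltration R X) : LinearMap.id ∈ (S.hom S).F 0 := fun m x hx => by
  simpa using hx

theorem id_mem_G (S : Superfiltration R X) : LinearMap.id ∈ (S.hom S).G 0 := fun m x hx => by
  simpa using hx

/-- An element of `F (p + 1)` whose parity is that of `p` lies in `F p`. -/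
theorem mem_F_of_mem_G (S : Superfiltration R X) {p : ℤ} {x : X} (hF : x ∈ S.F (p + 1))
    (hG : x ∈ S.G (p : ZMod 2)) : x ∈ S.F p :=
  ((S.jump p).le ⟨hF, hG⟩).1

theorem sign_even (S : Superfiltration R X) {x : X} (hx : x ∈ S.G 0) : S.sign x = x := by
  simpa using S.sign_of_mem (i := 0) (by simpa using hx)

theorem sign_odd (S : Superfiltration R X) {x : X} (hx : x ∈ S.G 1) : S.sign x = -x := by
  simpa using S.sign_of_mem (i := 1) (by simpa using hx)

theorem sign_apply_mem_G (S : Superfiltration R X) {i : ZMod 2} {x : X} (hx : x ∈ S.G i) :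
    S.sign x ∈ S.G i := by
  fin_cases i
  · exact (S.sign_even hx).symm ▸ hx
  · exact (S.sign_odd hx).symm ▸ neg_mem hx

theorem sign_mem_G (S : Superfiltration R X) : S.sign ∈ (S.hom S).G 0 := fun p x hx => by
  rw [add_zero]
  exact S.sign_apply_mem_G hx

theorem sign_sign (S : Superfiltration R X) (x : X) : S.sign (S.sign x) = x := by
  rw [← S.proj_add x, map_add, S.sign_even (S.proj_mem 0 x), S.sign_odd (S.proj_mem 1 x), map_add,
    map_neg, S.sign_even (S.proj_mem 0 x), S.sign_odd (S.proj_mem 1 x), neg_neg]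

theorem sign_odd_apply {S : Superfiltration R X} {S' : Superfiltration R Y} {f : X →ₗ[R] Y}
    (hf : f ∈ (S.hom S').G 1) (x : X) : S'.sign (f x) = -f (S.sign x) := by
  rw [← S.proj_add x, map_add f, map_add, map_add S.sign, S.sign_even (S.proj_mem 0 x),
    S.sign_odd (S.proj_mem 1 x), map_add f, map_neg,
    S'.sign_odd (by simpa using hf 0 _ (S.proj_mem 0 x)),
    S'.sign_even (hf 1 _ (S.proj_mem 1 x))]
  abel

theorem sign_even_apply {S : Superfiltration R X} {S' : Superfiltration R Y} {f : X →ₗ[R] Y}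
    (hf : f ∈ (S.hom S').G 0) (x : X) : S'.sign (f x) = f (S.sign x) := by
  rw [← S.proj_add x, map_add f, map_add, map_add S.sign, S.sign_even (S.proj_mem 0 x),
    S.sign_odd (S.proj_mem 1 x), map_add f, map_neg,
    S'.sign_even (by simpa using hf 0 _ (S.proj_mem 0 x)),
    S'.sign_odd (by simpa using hf 1 _ (S.proj_mem 1 x))]

end HomogeneousBasis

end Superfiltration

open Superfiltration

/-! ### The filtrations on E and E_R in terms of the monomial basis and of power series
coefficients. -/

section Exterior

variable {R₀ : Type u} [CommRing R₀] {V : Type v} [AddCommGroup V] [Module R₀ V] {n : ℕ}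

theorem basis_mem_degree (b : Module.Basis (Fin n) R₀ V) (s : Finset (Fin n)) :
    b.ExteriorAlgebra s ∈ ⋀[R₀]^s.card V := by
  rw [ExteriorAlgebra.basis_apply_ofCard b rfl, ← exteriorPower.ιMulti_family_apply_coe]
  exact Subtype.prop _

/-- The basis of `E_R` induced by a basis of `V`. -/
noncomputable abbrev extRBasis (b : Module.Basis (Fin n) R₀ V) :
    Module.Basis (Finset (Fin n)) (FormalRing R₀ n) (ExtR R₀ V n) :=
  b.ExteriorAlgebra.baseChange (FormalRing R₀ n)

theorem extRBasis_mem_degree (b : Module.Basis (Fin n) R₀ V) (s : Finset (Fin n)) :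
    extRBasis b s ∈ (⋀[R₀]^s.card V).baseChange (FormalRing R₀ n) := by
  rw [extRBasis, Module.Basis.baseChange_apply]
  exact Submodule.tmul_mem_baseChange_of_mem _ (basis_mem_degree b s)

theorem mem_extSF_F (b : Module.Basis (Fin n) R₀ V) {p : ℤ} {x : ExteriorAlgebra R₀ V} :
    x ∈ (extSF R₀ V).F p ↔ ∀ s : Finset (Fin n), p < s.card → b.ExteriorAlgebra.repr x s = 0 :=
  mem_F_ofGrading (𝒜 := fun q : ℕ => ⋀[R₀]^q V) b.ExteriorAlgebra (basis_mem_degree b)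

theorem mem_extSF_G (b : Module.Basis (Fin n) R₀ V) {i : ZMod 2} {x : ExteriorAlgebra R₀ V} :
    x ∈ (extSF R₀ V).G i ↔
      ∀ s : Finset (Fin n), (s.card : ZMod 2) ≠ i → b.ExteriorAlgebra.repr x s = 0 :=
  mem_G_ofGrading (𝒜 := fun q : ℕ => ⋀[R₀]^q V) b.ExteriorAlgebra (basis_mem_degree b)

theorem mem_extRSF_F (b : Module.Basis (Fin n) R₀ V) {p : ℤ} {x : ExtR R₀ V n} :
    x ∈ (extRSF R₀ V n).F p ↔ ∀ s : Finset (Fin n), p < s.card → (extRBasis b).repr x s = 0 :=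
  mem_F_ofGrading (extRBasis b) (extRBasis_mem_degree b)

theorem mem_extRSF_G (b : Module.Basis (Fin n) R₀ V) {i : ZMod 2} {x : ExtR R₀ V n} :
    x ∈ (extRSF R₀ V n).G i ↔
      ∀ s : Finset (Fin n), (s.card : ZMod 2) ≠ i → (extRBasis b).repr x s = 0 :=
  mem_G_ofGrading (extRBasis b) (extRBasis_mem_degree b)

/-- Extracting a power series coefficient commutes with extracting a coordinate. Statements over R
thus reduce to statements over R₀, one monomial at a time, and the mirror differential is given in
that form. -/
theorem coeff_extRBasis_repr (b : Module.Basis (Fin n) R₀ V) (x : ExtR R₀ V n)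
    (s : Finset (Fin n)) (m : Fin n →₀ ℕ) :
    MvPowerSeries.coeff m ((extRBasis b).repr x s) = b.ExteriorAlgebra.repr (coeffE m x) s := by
  induction x using TensorProduct.induction_on with
  | zero => simp
  | add x y hx hy => simp [hx, hy]
  | tmul r a =>
    simp [coeffE, Module.Basis.baseChange_repr_tmul, mul_comm]

theorem mem_extRSF_F_iff (b : Module.Basis (Fin n) R₀ V) {p : ℤ} {x : ExtR R₀ V n} :
    x ∈ (extRSF R₀ V n).F p ↔ ∀ m, coeffE m x ∈ (extSF R₀ V).F p := by
  simp only [mem_extRSF_F b, mem_extSF_F b, ← coeff_extRBasis_repr, MvPowerSeries.ext_iff, map_zero]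
  exact ⟨fun h m s hs => h s hs m, fun h s hs m => h m s hs⟩

theorem mem_extRSF_G_iff (b : Module.Basis (Fin n) R₀ V) {i : ZMod 2} {x : ExtR R₀ V n} :
    x ∈ (extRSF R₀ V n).G i ↔ ∀ m, coeffE m x ∈ (extSF R₀ V).G i := by
  simp only [mem_extRSF_G b, mem_extSF_G b, ← coeff_extRBasis_repr, MvPowerSeries.ext_iff, map_zero]
  exact ⟨fun h m s hs => h s hs m, fun h s hs m => h m s hs⟩

theorem extR_ext (b : Module.Basis (Fin n) R₀ V) {x y : ExtR R₀ V n}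
    (h : ∀ m, coeffE m x = coeffE m y) : x = y := by
  refine (extRBasis b).ext_elem fun s => MvPowerSeries.ext fun m => ?_
  rw [coeff_extRBasis_repr, coeff_extRBasis_repr, h]

theorem coeffE_tmul (m : Fin n →₀ ℕ) (r : FormalRing R₀ n) (a : ExteriorAlgebra R₀ V) :
    coeffE m (r ⊗ₜ[R₀] a) = MvPowerSeries.coeff m r • a := by
  simp [coeffE]

theorem tmul_mem_extRSF_F (b : Module.Basis (Fin n) R₀ V) {p : ℤ} (r : FormalRing R₀ n)
    {a : ExteriorAlgebra R₀ V} (ha : a ∈ (extSF R₀ V).F p) : r ⊗ₜ[R₀] a ∈ (extRSF R₀ V n).F p := by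
  rw [mem_extRSF_F_iff b]
  intro m
  rw [coeffE_tmul]
  exact Submodule.smul_mem _ _ ha

theorem tmul_mem_extRSF_G (b : Module.Basis (Fin n) R₀ V) {i : ZMod 2} (r : FormalRing R₀ n)
    {a : ExteriorAlgebra R₀ V} (ha : a ∈ (extSF R₀ V).G i) : r ⊗ₜ[R₀] a ∈ (extRSF R₀ V n).G i := by
  rw [mem_extRSF_G_iff b]
  intro m
  rw [coeffE_tmul]
  exact Submodule.smul_mem _ _ ha

theorem basis_mem_extSF_F (b : Module.Basis (Fin n) R₀ V) (s : Finset (Fin n)) :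
    b.ExteriorAlgebra s ∈ (extSF R₀ V).F s.card :=
  mem_F_of_mem_degree le_rfl (basis_mem_degree b s)

theorem basis_mem_extSF_G (b : Module.Basis (Fin n) R₀ V) (s : Finset (Fin n)) :
    b.ExteriorAlgebra s ∈ (extSF R₀ V).G s.card :=
  mem_G_of_mem_degree rfl (basis_mem_degree b s)

/-- To map `F^p` into an additive subgroup it suffices to do so on multiples of the basis elements
of degree at most `p`. -/
theorem extRSF_F_induction (b : Module.Basis (Fin n) R₀ V) {p : ℤ} {x : ExtR R₀ V n}
    (hx : x ∈ (extRSF R₀ V n).F p) {M : Type*} [AddCommGroup M] (N : AddSubgroup M)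
    (f : ExtR R₀ V n →+ M)
    (hf : ∀ (r : FormalRing R₀ n) (s : Finset (Fin n)), (s.card : ℤ) ≤ p →
      f (r ⊗ₜ b.ExteriorAlgebra s) ∈ N) : f x ∈ N := by
  rw [← (extRBasis b).sum_repr x, map_sum]
  refine sum_mem fun s _ => ?_
  rw [extRBasis, Module.Basis.baseChange_apply, TensorProduct.smul_tmul', smul_eq_mul, mul_one]
  rcases le_or_gt (s.card : ℤ) p with h | h
  · exact hf _ _ h
  · rw [(mem_extRSF_F b).1 hx s h, TensorProduct.zero_tmul, map_zero]
    exact zero_mem _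

theorem extRSF_G_induction (b : Module.Basis (Fin n) R₀ V) {i : ZMod 2} {x : ExtR R₀ V n}
    (hx : x ∈ (extRSF R₀ V n).G i) {M : Type*} [AddCommGroup M] (N : AddSubgroup M)
    (f : ExtR R₀ V n →+ M)
    (hf : ∀ (r : FormalRing R₀ n) (s : Finset (Fin n)), (s.card : ZMod 2) = i →
      f (r ⊗ₜ b.ExteriorAlgebra s) ∈ N) : f x ∈ N := by
  rw [← (extRBasis b).sum_repr x, map_sum]
  refine sum_mem fun s _ => ?_
  rw [extRBasis, Module.Basis.baseChange_apply, TensorProduct.smul_tmul', smul_eq_mul, mul_one]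
  by_cases h : (s.card : ZMod 2) = i
  · exact hf _ _ h
  · rw [(mem_extRSF_G b).1 hx s h, TensorProduct.zero_tmul, map_zero]
    exact zero_mem _

/-- The filtration only sees the exterior factor. The other factor need only be R₀-linear, so that
division by a variable is allowed. -/
theorem map_mem_extRSF_F (b : Module.Basis (Fin n) R₀ V) (g : FormalRing R₀ n →ₗ[R₀] FormalRing R₀ n)
    {f : ExteriorAlgebra R₀ V →ₗ[R₀] ExteriorAlgebra R₀ V} {p q : ℤ}
    (hf : f ∈ ((extSF R₀ V).hom (extSF R₀ V)).F p) {x : ExtR R₀ V n}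
    (hx : x ∈ (extRSF R₀ V n).F q) : TensorProduct.map g f x ∈ (extRSF R₀ V n).F (q + p) := by
  refine extRSF_F_induction b hx ((extRSF R₀ V n).F (q + p)).toAddSubgroup
    (TensorProduct.map g f).toAddMonoidHom fun r s hs => ?_
  exact tmul_mem_extRSF_F b _ (hf _ _ ((extSF R₀ V).mono hs (basis_mem_extSF_F b s)))

theorem map_mem_extRSF_G (b : Module.Basis (Fin n) R₀ V) (g : FormalRing R₀ n →ₗ[R₀] FormalRing R₀ n)
    {f : ExteriorAlgebra R₀ V →ₗ[R₀] ExteriorAlgebra R₀ V} {i j : ZMod 2}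
    (hf : f ∈ ((extSF R₀ V).hom (extSF R₀ V)).G i) {x : ExtR R₀ V n}
    (hx : x ∈ (extRSF R₀ V n).G j) : TensorProduct.map g f x ∈ (extRSF R₀ V n).G (j + i) := by
  refine extRSF_G_induction b hx ((extRSF R₀ V n).G (j + i)).toAddSubgroup
    (TensorProduct.map g f).toAddMonoidHom fun r s hs => ?_
  exact tmul_mem_extRSF_G b _ (hf _ _ (hs ▸ basis_mem_extSF_G b s))

theorem hom_extSF_mem_F (b : Module.Basis (Fin n) R₀ V) {p : ℤ}
    {f : ExteriorAlgebra R₀ V →ₗ[R₀] ExteriorAlgebra R₀ V}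
    (hf : ∀ q : ℕ, ∀ x ∈ ⋀[R₀]^q V, f x ∈ (extSF R₀ V).F (q + p)) :
    f ∈ ((extSF R₀ V).hom (extSF R₀ V)).F p := fun q x hx => by
  rw [← b.ExteriorAlgebra.sum_repr x, map_sum]
  refine sum_mem fun s _ => ?_
  rw [map_smul]
  rcases le_or_gt (s.card : ℤ) q with h | h
  · exact Submodule.smul_mem _ _ ((extSF R₀ V).mono (by lia) (hf _ _ (basis_mem_degree b s)))
  · rw [(mem_extSF_F b).1 hx s h, zero_smul]
    exact zero_mem _

theorem hom_extSF_mem_G (b : Module.Basis (Fin n) R₀ V) {i : ZMod 2}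
    {f : ExteriorAlgebra R₀ V →ₗ[R₀] ExteriorAlgebra R₀ V}
    (hf : ∀ q : ℕ, ∀ x ∈ ⋀[R₀]^q V, f x ∈ (extSF R₀ V).G (q + i)) :
    f ∈ ((extSF R₀ V).hom (extSF R₀ V)).G i := fun j x hx => by
  rw [← b.ExteriorAlgebra.sum_repr x, map_sum]
  refine sum_mem fun s _ => ?_
  rw [map_smul]
  by_cases h : (s.card : ZMod 2) = j
  · exact Submodule.smul_mem _ _ (h ▸ hf _ _ (basis_mem_degree b s))
  · rw [(mem_extSF_G b).1 hx s h, zero_smul]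
    exact zero_mem _

theorem extRSF_F_top (b : Module.Basis (Fin n) R₀ V) : (extRSF R₀ V n).F n = ⊤ := by
  refine (Submodule.eq_top_iff').2 fun x => (mem_extRSF_F b).2 fun s hs => ?_
  have := s.card_le_univ
  simp only [Fintype.card_fin] at this
  lia

theorem extRSF_F_bot (b : Module.Basis (Fin n) R₀ V) : (extRSF R₀ V n).F (-1) = ⊥ := by
  refine (Submodule.eq_bot_iff _).2 fun x hx => (extRBasis b).ext_elem fun s => ?_
  rw [(mem_extRSF_F b).1 hx s (by lia), map_zero, Finsupp.zero_apply]

end Exterior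

end SuperMF

/-! ### A contracting homotopy for the Koszul complex, one variable at a time. -/

namespace SuperMF

open Superfiltration

/-- Tensor products of contracting homotopies: from homotopies `H i` with
`K i * H i + H i * K i = 1 - p i` one obtains a homotopy for `∑ K i`, relative to a product of
the `p i`. -/
theorem exists_homotopy_sum {A ι : Type*} [Ring A] [DecidableEq ι] {K H p : ι → A} {L P : Set A}
    (hKH : ∀ i, K i * H i + H i * K i = 1 - p i)
    (hKH' : ∀ i j, i ≠ j → K i * H j + H j * K i = 0)
    (hpK : ∀ i, p i * K i = 0) (hKp : ∀ i, K i * p i = 0)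
    (hpK' : ∀ i j, i ≠ j → p i * K j = K j * p i)
    (hpp : ∀ i j, p i * p j = p j * p i)
    (hL0 : 0 ∈ L) (hLadd : ∀ x ∈ L, ∀ y ∈ L, x + y ∈ L) (hLP : ∀ x ∈ L, ∀ y ∈ P, x * y ∈ L)
    (hP1 : 1 ∈ P) (hPP : ∀ x ∈ P, ∀ y ∈ P, x * y ∈ P) (hH : ∀ i, H i ∈ L) (hp : ∀ i, p i ∈ P)
    (S : Finset ι) :
    ∃ h ∈ L, ∃ q ∈ P, (∑ i ∈ S, K i) * h + h * (∑ i ∈ S, K i) = 1 - q ∧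
      q * (∑ i ∈ S, K i) = 0 ∧ (∑ i ∈ S, K i) * q = 0 ∧
      (∀ j ∉ S, q * K j = K j * q ∧ K j * h + h * K j = 0) ∧ (∀ j, q * p j = p j * q) ∧
      ∀ i ∈ S, ∃ r, q = r * p i := by
  induction S using Finset.induction_on with
  | empty => exact ⟨0, hL0, 1, hP1, by simp⟩
  | insert j S hj ih =>
    obtain ⟨h, hhL, q, hqP, h1, h2, h3, h4, h5, h6⟩ := ih
    have hjS : ∀ x : A, (∀ i, i ≠ j → x * K i = K i * x) →
        x * (∑ i ∈ S, K i) = (∑ i ∈ S, K i) * x := fun x hx => by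
      rw [Finset.mul_sum, Finset.sum_mul]
      exact Finset.sum_congr rfl fun i hi => hx i (by rintro rfl; exact hj hi)
    have hHS : (∑ i ∈ S, K i) * H j + H j * (∑ i ∈ S, K i) = 0 := by
      rw [Finset.mul_sum, Finset.sum_mul, ← Finset.sum_add_distrib]
      exact Finset.sum_eq_zero fun i hi => hKH' i j (by rintro rfl; exact hj hi)
    have hpS := hjS (p j) fun i hi => hpK' j i hi.symm
    obtain ⟨h7, h8⟩ := h4 j hj
    -- The usual homotopy on a tensor product: the old homotopy, plus the new one on the image of
    -- the projection q onto the old cohomology. The new part contributes (1 - p_j) q, and (1 - q) +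
    -- (1 - p_j) q = 1 - p_j q. The cross terms vanish because q and the old differential annihilate
    -- each other. Membership in L and P keeps track of the shifts of filtration and parity.
    refine ⟨h + H j * q, hLadd _ hhL _ (hLP _ (hH j) _ hqP), p j * q, hPP _ (hp j) _ hqP,
      ?_, ?_, ?_, ?_, ?_, ?_⟩
    · rw [Finset.sum_insert hj]
      set KS := ∑ i ∈ S, K i
      calc (K j + KS) * (h + H j * q) + (h + H j * q) * (K j + KS)
          = (KS * h + h * KS) + (K j * h + h * K j) + (KS * H j) * q + H j * (q * KS)
            + (K j * H j * q + H j * (q * K j)) := by noncomm_ring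
        _ = (1 - q) + 0 + (-(H j * KS)) * q + 0 + (K j * H j + H j * K j) * q := by
          rw [h1, h8, h2, h7, eq_neg_of_add_eq_zero_left hHS]; noncomm_ring
        _ = (1 - q) - H j * (KS * q) + (1 - p j) * q := by rw [hKH]; noncomm_ring
        _ = 1 - p j * q := by rw [h3]; noncomm_ring
    · rw [Finset.sum_insert hj, mul_add, mul_assoc, mul_assoc, h2, h7, ← mul_assoc, hpK, zero_mul,
        mul_zero, add_zero]
    · rw [Finset.sum_insert hj, add_mul, ← mul_assoc, ← mul_assoc, hKp, ← hpS, mul_assoc, h3,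
        zero_mul, mul_zero, add_zero]
    · intro k hk
      simp only [Finset.mem_insert, not_or] at hk
      obtain ⟨h9, h10⟩ := h4 k hk.2
      refine ⟨?_, ?_⟩
      · rw [mul_assoc, h9, ← mul_assoc, hpK' j k (Ne.symm hk.1), mul_assoc]
      · calc K k * (h + H j * q) + (h + H j * q) * K k
            = (K k * h + h * K k) + K k * H j * q + H j * (q * K k) := by noncomm_ring
          _ = (K k * H j + H j * K k) * q := by rw [h10, h9]; noncomm_ring
          _ = 0 := by rw [hKH' k j hk.1, zero_mul]
    · intro k
      rw [mul_assoc, h5, ← mul_assoc, hpp, mul_assoc]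
    · intro i hi
      rcases Finset.mem_insert.1 hi with rfl | hi
      · exact ⟨q, (h5 i).symm⟩
      · obtain ⟨r, hr⟩ := h6 i hi
        exact ⟨p j * r, by rw [mul_assoc, ← hr]⟩

section Exterior

variable {R₀ : Type u} [CommRing R₀] {V : Type v} [AddCommGroup V] [Module R₀ V] {n : ℕ}

/-- Left multiplication by a basis vector, on the exterior algebra. -/
noncomputable def wedge (b : Module.Basis (Fin n) R₀ V) (i : Fin n) :
    Module.End R₀ (ExteriorAlgebra R₀ V) :=
  LinearMap.mulLeft R₀ (ExteriorAlgebra.ι R₀ (b i))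

/-- Contraction with a dual basis vector, on the exterior algebra. -/
noncomputable def contract (b : Module.Basis (Fin n) R₀ V) (i : Fin n) :
    Module.End R₀ (ExteriorAlgebra R₀ V) :=
  CliffordAlgebra.contractLeft (Q := (0 : QuadraticForm R₀ V)) (b.coord i)

variable (b : Module.Basis (Fin n) R₀ V)

theorem wedge_mul_self (i : Fin n) : wedge b i * wedge b i = 0 := by
  ext x
  simp [wedge, ← mul_assoc]

theorem wedge_mul_wedge (i j : Fin n) : wedge b i * wedge b j = -(wedge b j * wedge b i) := by
  refine LinearMap.ext fun x => ?_
  simp only [wedge, Module.End.mul_apply, LinearMap.mulLeft_apply, LinearMap.neg_apply,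
    ← mul_assoc, ← neg_mul]
  rw [eq_neg_of_add_eq_zero_left (ExteriorAlgebra.ι_add_mul_swap (b i) (b j)), neg_mul, neg_mul, neg_mul]

theorem contract_mul_self (i : Fin n) : contract b i * contract b i = 0 :=
  LinearMap.ext fun _ => CliffordAlgebra.contractLeft_contractLeft _ _

theorem contract_mul_contract (i j : Fin n) :
    contract b i * contract b j = -(contract b j * contract b i) :=
  LinearMap.ext fun _ => CliffordAlgebra.contractLeft_comm _ _ _

theorem contract_mul_wedge (i j : Fin n) :
    contract b i * wedge b j = (if i = j then 1 else 0) - wedge b j * contract b i := by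
  refine LinearMap.ext fun x => ?_
  have := CliffordAlgebra.contractLeft_ι_mul (Q := (0 : QuadraticForm R₀ V)) (d := b.coord i)
    (b j) x
  refine Eq.trans this ?_
  simp only [Module.Basis.coord_apply, Module.Basis.repr_self, Finsupp.single_apply, eq_comm (a := j)]
  split_ifs <;> simp [wedge, contract, ExteriorAlgebra.ι]

theorem ι_mul_mem_degree (v : V) {q : ℕ} {x : ExteriorAlgebra R₀ V} (hx : x ∈ ⋀[R₀]^q V) :
    ExteriorAlgebra.ι R₀ v * x ∈ ⋀[R₀]^(q + 1) V := by
  have h : (LinearMap.range (ExteriorAlgebra.ι R₀ : V →ₗ[R₀] _)) ^ (q + 1) = _ := pow_succ' _ q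
  exact h.ge <| Submodule.mul_mem_mul (LinearMap.mem_range_self _ _) hx

theorem wedge_mem_F (i : Fin n) : wedge b i ∈ ((extSF R₀ V).hom (extSF R₀ V)).F 1 := by
  refine hom_extSF_mem_F b fun q x hx => ?_
  refine mem_F_of_mem_degree (q := q + 1) (by simp) ?_
  exact ι_mul_mem_degree _ hx

theorem wedge_mem_G (i : Fin n) : wedge b i ∈ ((extSF R₀ V).hom (extSF R₀ V)).G 1 := by
  refine hom_extSF_mem_G b fun q x hx => ?_
  refine mem_G_of_mem_degree (q := q + 1) (by simp) ?_
  exact ι_mul_mem_degree _ hx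

/-- Induction by the antiderivation rule. The case distinction replaces the degree q - 1, which
would be truncated at q = 0. -/
theorem contract_mem_degree (i : Fin n) {q : ℕ} {x : ExteriorAlgebra R₀ V} (hx : x ∈ ⋀[R₀]^q V) :
    q = 0 ∧ contract b i x = 0 ∨ ∃ r, q = r + 1 ∧ contract b i x ∈ ⋀[R₀]^r V := by
  induction hx using Submodule.pow_induction_on_left' with
  | algebraMap r => exact Or.inl ⟨rfl, CliffordAlgebra.contractLeft_algebraMap _ (b.coord i) r⟩
  | add x y q hx hy ihx ihy =>
    rcases ihx with ⟨rfl, ihx⟩ | ⟨r, rfl, ihx⟩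
    · rcases ihy with ⟨-, ihy⟩ | ⟨r, h, ihy⟩
      · exact Or.inl ⟨rfl, by rw [map_add, ihx, ihy, add_zero]⟩
      · exact absurd h (by lia)
    · rcases ihy with ⟨h, ihy⟩ | ⟨r', h, ihy⟩
      · exact absurd h (by lia)
      · obtain rfl : r = r' := by lia
        exact Or.inr ⟨r, rfl, by rw [map_add]; exact add_mem ihx ihy⟩
  | mem_mul m hm q x hx ih =>
    obtain ⟨m, rfl⟩ := hm
    refine Or.inr ⟨q, rfl, ?_⟩
    have := CliffordAlgebra.contractLeft_ι_mul (Q := (0 : QuadraticForm R₀ V)) (d := b.coord i) m x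
    rw [contract, ExteriorAlgebra.ι, this]
    refine sub_mem (Submodule.smul_mem _ _ hx) ?_
    rcases ih with ⟨rfl, ih⟩ | ⟨r, rfl, ih⟩
    · rw [contract] at ih
      rw [ih, mul_zero]
      exact zero_mem _
    · exact ι_mul_mem_degree _ ih

theorem contract_mem_F (i : Fin n) : contract b i ∈ ((extSF R₀ V).hom (extSF R₀ V)).F (-1) := by
  refine hom_extSF_mem_F b fun q x hx => ?_
  rcases contract_mem_degree b i hx with ⟨-, h⟩ | ⟨r, rfl, h⟩
  · rw [h]
    exact zero_mem _
  · exact mem_F_of_mem_degree (by simp) h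

theorem contract_mem_G (i : Fin n) : contract b i ∈ ((extSF R₀ V).hom (extSF R₀ V)).G 1 := by
  refine hom_extSF_mem_G b fun q x hx => ?_
  rcases contract_mem_degree b i hx with ⟨-, h⟩ | ⟨r, rfl, h⟩
  · rw [h]
    exact zero_mem _
  · refine mem_G_of_mem_degree ?_ h
    push_cast
    rw [add_assoc, CharTwo.add_self_eq_zero, add_zero]

/-- The contraction anticommutes past every factor v_j with j ≠ i and finally kills 1. -/
theorem contract_basis (i : Fin n) {s : Finset (Fin n)} (hi : i ∉ s) :
    contract b i (b.ExteriorAlgebra s) = 0 := by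
  rw [ExteriorAlgebra.basis_apply_ofCard b rfl, ExteriorAlgebra.ιMulti_family,
    ExteriorAlgebra.ιMulti_apply]
  have key : ∀ l : List (Fin n), i ∉ l →
      contract b i (l.map fun j => ExteriorAlgebra.ι R₀ (b j)).prod = 0 := by
    intro l
    induction l with
    | nil => exact fun _ => CliffordAlgebra.contractLeft_one _ (b.coord i)
    | cons j l ih =>
      intro hl
      simp only [List.mem_cons, not_or] at hl
      have := LinearMap.congr_fun (contract_mul_wedge b i j)
        (l.map fun j => ExteriorAlgebra.ι R₀ (b j)).prod
      rw [if_neg hl.1] at this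
      rw [List.map_cons, List.prod_cons]
      refine this.trans ?_
      simp [ih hl.2]
  have h := key (List.ofFn fun j => Set.powersetCard.ofFinEmbEquiv.symm
    (Set.powersetCard.ofCard (rfl : s.card = s.card)) j) ?_
  · rw [List.map_ofFn] at h
    exact h
  · simp only [List.mem_ofFn, not_exists]
    rintro j rfl
    exact hi ((Set.powersetCard.mem_range_ofFinEmbEquiv_symm_iff_mem
      (Set.powersetCard.ofCard (rfl : s.card = s.card)) _).1 ⟨j, rfl⟩)

/-- Multiplication by a variable. -/
noncomputable def mulX (R₀ : Type u) [CommRing R₀] {n : ℕ} (i : Fin n) :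
    Module.End R₀ (FormalRing R₀ n) :=
  LinearMap.mulLeft R₀ (MvPowerSeries.X i)

/-- Division by a variable, killing the monomials not divisible by it. -/
noncomputable def divX (R₀ : Type u) [CommRing R₀] {n : ℕ} (i : Fin n) : Module.End R₀ (FormalRing R₀ n) where
  toFun f := fun m => MvPowerSeries.coeff (m + Finsupp.single i 1) f
  map_add' f g := by ext m; rfl
  map_smul' c f := by ext m; rfl

theorem coeff_divX (i : Fin n) (m : Fin n →₀ ℕ) (f : FormalRing R₀ n) :
    MvPowerSeries.coeff m (divX R₀ i f) = MvPowerSeries.coeff (m + Finsupp.single i 1) f := rfl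

theorem coeff_mulX (i : Fin n) (m : Fin n →₀ ℕ) (f : FormalRing R₀ n) :
    MvPowerSeries.coeff m (mulX R₀ i f) =
      if 1 ≤ m i then MvPowerSeries.coeff (m - Finsupp.single i 1) f else 0 := by
  rw [mulX, LinearMap.mulLeft_apply, MvPowerSeries.X, MvPowerSeries.coeff_monomial_mul]
  simp [Finsupp.single_le_iff]

theorem divX_mul_mulX (i : Fin n) : divX R₀ i * mulX R₀ i = 1 := by
  refine LinearMap.ext fun f => MvPowerSeries.ext fun m => ?_
  simp [coeff_divX, coeff_mulX]

theorem divX_mul_mulX_comm {i j : Fin n} (h : i ≠ j) :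
    divX R₀ i * mulX R₀ j = mulX R₀ j * divX R₀ i := by
  refine LinearMap.ext fun f => MvPowerSeries.ext fun m => ?_
  simp only [Module.End.mul_apply, coeff_divX, coeff_mulX, Finsupp.add_apply,
    Finsupp.single_apply, if_neg h, add_zero]
  refine if_congr Iff.rfl ?_ rfl
  congr 2
  ext k
  simp only [Finsupp.add_apply, Finsupp.tsub_apply, Finsupp.single_apply]
  split_ifs with h1 h2 <;> first | (subst h1; exact absurd h2.symm h) | lia

theorem divX_mul_divX (i j : Fin n) : divX R₀ i * divX R₀ j = divX R₀ j * divX R₀ i := by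
  refine LinearMap.ext fun f => MvPowerSeries.ext fun m => ?_
  simp only [Module.End.mul_apply, coeff_divX, add_right_comm]

theorem mulX_mul_mulX (i j : Fin n) : mulX R₀ i * mulX R₀ j = mulX R₀ j * mulX R₀ i := by
  refine LinearMap.ext fun f => ?_
  simp [mulX, mul_left_comm]

theorem one_sub_mul_comm {A : Type*} [Ring A] {x y z : A} (h : x * z = z * x) (h' : y * z = z * y) :
    (1 - x * y) * z = z * (1 - x * y) := by
  rw [sub_mul, mul_sub, mul_assoc, h', ← mul_assoc, h, mul_assoc, one_mul, mul_one]

theorem mul_mul_comm_of_anticomm {A : Type*} [Ring A] {x y z : A} (h : x * z = -(z * x))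
    (h' : y * z = -(z * y)) : x * y * z = z * (x * y) := by
  rw [mul_assoc, h', mul_neg, ← mul_assoc, h, neg_mul, neg_neg, mul_assoc]

theorem contract_mul_wedge_of_ne {i j : Fin n} (hij : i ≠ j) :
    contract b i * wedge b j = -(wedge b j * contract b i) := by
  rw [contract_mul_wedge, if_neg hij]
  exact zero_sub _

theorem wedge_mul_contract_mul_wedge {i j : Fin n} (hij : i ≠ j) :
    wedge b i * contract b i * wedge b j = wedge b j * (wedge b i * contract b i) :=
  mul_mul_comm_of_anticomm (wedge_mul_wedge b i j) (contract_mul_wedge_of_ne b hij)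

theorem wedge_mul_contract_mul_contract {i j : Fin n} (hij : i ≠ j) :
    wedge b i * contract b i * contract b j = contract b j * (wedge b i * contract b i) :=
  mul_mul_comm_of_anticomm (by rw [contract_mul_wedge_of_ne b hij.symm]; exact (neg_neg _).symm)
    (contract_mul_contract b i j)

/-- The summand `x_i v_i ∧ -` of the Koszul differential. -/
noncomputable def koszulTerm (i : Fin n) : Module.End R₀ (ExtR R₀ V n) :=
  TensorProduct.map (mulX R₀ i) (wedge b i)

/-- The contracting homotopy in the direction of the `i`-th variable. -/
noncomputable def homotopyTerm (i : Fin n) : Module.End R₀ (ExtR R₀ V n) :=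
  TensorProduct.map (divX R₀ i) (contract b i)

/-- The projection onto the cohomology of the `i`-th summand of the Koszul differential. -/
noncomputable def cohomologyProj (i : Fin n) : Module.End R₀ (ExtR R₀ V n) :=
  TensorProduct.map (1 - mulX R₀ i * divX R₀ i) (wedge b i * contract b i)

theorem map_mul_map (f f' : Module.End R₀ (FormalRing R₀ n))
    (g g' : Module.End R₀ (ExteriorAlgebra R₀ V)) :
    (TensorProduct.map f g * TensorProduct.map f' g' : Module.End R₀ (ExtR R₀ V n)) =
      TensorProduct.map (f * f') (g * g') :=
  (TensorProduct.map_mul _ _ _ _).symm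

/-- With x and δ for multiplication and division by the variable, e and c for wedge and contraction,
δx = 1 and ce = 1 - ec give xδ ⊗ ec + 1 ⊗ (1 - ec) = 1 - (1 - xδ) ⊗ ec. What survives is v_i times
series free of x_i. -/
theorem koszulTerm_homotopyTerm_self (i : Fin n) :
    koszulTerm b i * homotopyTerm b i + homotopyTerm b i * koszulTerm b i =
      1 - cohomologyProj b i := by
  rw [koszulTerm, homotopyTerm, cohomologyProj, map_mul_map, map_mul_map, divX_mul_mulX,
    contract_mul_wedge, if_pos rfl]
  refine TensorProduct.ext' fun r a => ?_
  simp [TensorProduct.sub_tmul, TensorProduct.tmul_sub]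
  abel

theorem koszulTerm_homotopyTerm {i j : Fin n} (hij : i ≠ j) :
    koszulTerm b i * homotopyTerm b j + homotopyTerm b j * koszulTerm b i = 0 := by
  rw [koszulTerm, homotopyTerm, map_mul_map, map_mul_map, divX_mul_mulX_comm hij.symm,
    contract_mul_wedge_of_ne b hij.symm]
  refine TensorProduct.ext' fun r a => ?_
  simp [TensorProduct.tmul_neg]

theorem cohomologyProj_mul_koszulTerm_self (i : Fin n) :
    cohomologyProj b i * koszulTerm b i = 0 := by
  rw [koszulTerm, cohomologyProj, map_mul_map, sub_mul, one_mul, mul_assoc, divX_mul_mulX, mul_one,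
    sub_self, TensorProduct.map_zero_left]

theorem koszulTerm_mul_cohomologyProj_self (i : Fin n) :
    koszulTerm b i * cohomologyProj b i = 0 := by
  rw [koszulTerm, cohomologyProj, map_mul_map, ← mul_assoc, wedge_mul_self, zero_mul,
    TensorProduct.map_zero_right]

theorem cohomologyProj_mul_koszulTerm {i j : Fin n} (hij : i ≠ j) :
    cohomologyProj b i * koszulTerm b j = koszulTerm b j * cohomologyProj b i := by
  rw [koszulTerm, cohomologyProj, map_mul_map, map_mul_map, wedge_mul_contract_mul_wedge b hij,
    one_sub_mul_comm (mulX_mul_mulX i j) (divX_mul_mulX_comm hij)]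

theorem cohomologyProj_mul_cohomologyProj (i j : Fin n) :
    cohomologyProj b i * cohomologyProj b j = cohomologyProj b j * cohomologyProj b i := by
  rcases eq_or_ne i j with rfl | hij
  · rfl
  rw [cohomologyProj, cohomologyProj, map_mul_map, map_mul_map]
  congr 1
  · refine one_sub_mul_comm ?_ ?_ <;> symm <;> apply one_sub_mul_comm
    · exact mulX_mul_mulX j i
    · exact divX_mul_mulX_comm hij.symm
    · exact (divX_mul_mulX_comm hij).symm
    · exact divX_mul_divX j i
  · rw [← mul_assoc, wedge_mul_contract_mul_wedge b hij, mul_assoc,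
      wedge_mul_contract_mul_contract b hij, mul_assoc]

theorem wedge_mul_contract_mem_F (i : Fin n) :
    wedge b i * contract b i ∈ ((extSF R₀ V).hom (extSF R₀ V)).F 0 := by
  rw [Module.End.mul_eq_comp]
  exact comp_mem_F (p := 1) (q := -1) (by simp) (wedge_mem_F b i) (contract_mem_F b i)

theorem wedge_mul_contract_mem_G (i : Fin n) :
    wedge b i * contract b i ∈ ((extSF R₀ V).hom (extSF R₀ V)).G 0 := by
  rw [Module.End.mul_eq_comp]
  exact comp_mem_G (i := 1) (j := 1) rfl (wedge_mem_G b i) (contract_mem_G b i)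

theorem koszulTerm_apply (i : Fin n) (x : ExtR R₀ V n) :
    koszulTerm b i x = (MvPowerSeries.X i ⊗ₜ[R₀] ExteriorAlgebra.ι R₀ (b i)) * x := by
  induction x using TensorProduct.induction_on with
  | zero => rw [map_zero]; exact (mul_zero _).symm
  | add x y hx hy => rw [map_add, hx, hy]; exact (mul_add _ _ _).symm
  | tmul r a => exact (Algebra.TensorProduct.tmul_mul_tmul _ _ _ _).symm

theorem sum_koszulTerm_apply (x : ExtR R₀ V n) :
    (∑ i, koszulTerm b i) x = canonicalV b * x := by
  rw [LinearMap.sum_apply, Finset.sum_congr rfl fun i _ => koszulTerm_apply b i x]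
  exact (Finset.sum_mul _ _ _).symm

variable (R₀ V n) in
/-- The `R₀`-linear endomorphisms which shift the filtration by `p` and the parity by `i`. -/
def shifting (p : ℤ) (i : ZMod 2) : Set (Module.End R₀ (ExtR R₀ V n)) :=
  {f | (∀ q, ∀ x ∈ (extRSF R₀ V n).F q, f x ∈ (extRSF R₀ V n).F (q + p)) ∧
    (∀ j, ∀ x ∈ (extRSF R₀ V n).G j, f x ∈ (extRSF R₀ V n).G (j + i))}

theorem mul_mem_shifting {p q r : ℤ} {i j k : ZMod 2} (hr : q + p = r) (hk : j + i = k)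
    {f g : Module.End R₀ (ExtR R₀ V n)} (hf : f ∈ shifting R₀ V n p i)
    (hg : g ∈ shifting R₀ V n q j) : f * g ∈ shifting R₀ V n r k := by
  subst hr hk
  exact ⟨fun r x hx => add_assoc r q p ▸ hf.1 _ _ (hg.1 r x hx),
    fun r x hx => add_assoc r j i ▸ hf.2 _ _ (hg.2 r x hx)⟩

theorem homotopyTerm_mem_shifting (i : Fin n) : homotopyTerm b i ∈ shifting R₀ V n (-1) 1 :=
  ⟨fun _ _ hx => map_mem_extRSF_F b _ (contract_mem_F b i) hx,
    fun _ _ hx => map_mem_extRSF_G b _ (contract_mem_G b i) hx⟩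

theorem cohomologyProj_mem_shifting (i : Fin n) : cohomologyProj b i ∈ shifting R₀ V n 0 0 :=
  ⟨fun _ _ hx => map_mem_extRSF_F b _ (wedge_mul_contract_mem_F b i) hx,
    fun _ _ hx => map_mem_extRSF_G b _ (wedge_mul_contract_mem_G b i) hx⟩

theorem add_mem_shifting {p : ℤ} {i : ZMod 2} {f g : Module.End R₀ (ExtR R₀ V n)}
    (hf : f ∈ shifting R₀ V n p i) (hg : g ∈ shifting R₀ V n p i) :
    f + g ∈ shifting R₀ V n p i :=
  ⟨fun p x hx => add_mem (hf.1 p x hx) (hg.1 p x hx),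
    fun p x hx => add_mem (hf.2 p x hx) (hg.2 p x hx)⟩

/-- A contracting homotopy for the Koszul complex `(E_R, v ∧ -)` away from the top degree. -/
theorem exists_koszul_homotopy : ∃ H ∈ shifting R₀ V n (-1) 1,
    ∀ x ∈ (extRSF R₀ V n).F (n - 1), canonicalV b * H x + H (canonicalV b * x) = x := by
  obtain ⟨h, hhL, q, -, h1, -, -, -, -, h2⟩ := exists_homotopy_sum
    (L := shifting R₀ V n (-1) 1) (P := shifting R₀ V n 0 0)
    (koszulTerm_homotopyTerm_self b) (fun i j => koszulTerm_homotopyTerm b)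
    (cohomologyProj_mul_koszulTerm_self b) (koszulTerm_mul_cohomologyProj_self b)
    (fun i j => cohomologyProj_mul_koszulTerm b) (cohomologyProj_mul_cohomologyProj b)
    ⟨fun _ _ _ => zero_mem _, fun _ _ _ => zero_mem _⟩
    (fun f hf g hg => add_mem_shifting hf hg)
    (fun f hf g hg => mul_mem_shifting (by simp) (by simp) hf hg)
    ⟨fun p x hx => by simpa using hx, fun p x hx => by simpa using hx⟩
    (fun f hf g hg => mul_mem_shifting (by simp) (by simp) hf hg)
    (homotopyTerm_mem_shifting b) (cohomologyProj_mem_shifting b) Finset.univ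
  refine ⟨h, hhL, fun x hx => ?_⟩
  have h3 := LinearMap.congr_fun h1 x
  rw [LinearMap.add_apply, Module.End.mul_apply, Module.End.mul_apply, sum_koszulTerm_apply,
    sum_koszulTerm_apply, LinearMap.sub_apply, Module.End.one_apply] at h3
  -- The projection q factors through each p_i, and p_i kills the monomials in which v_i is missing.
  -- A monomial of degree at most n - 1 misses some v_i.
  have h4 : q x = 0 := by
    refine (AddSubgroup.mem_bot).1 (extRSF_F_induction b hx ⊥ q.toAddMonoidHom fun r s hs => ?_)
    obtain ⟨i, hi⟩ : ∃ i, i ∉ s := by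
      by_contra! hc
      rw [Finset.eq_univ_iff_forall.2 hc] at hs
      simp at hs
    obtain ⟨r', rfl⟩ := h2 i (Finset.mem_univ i)
    simp [cohomologyProj, contract_basis b i hi]
  rw [h3, h4, sub_zero]

end Exterior

end SuperMF

/-! ### Lifting the identity to a closed map, and inverting the lift. -/

namespace SuperMF

open Superfiltration

section Lifting

variable {R X ι : Type*} [CommRing R] [AddCommGroup X] [Module R X] {S : Superfiltration R X}
  {B : Module.Basis ι R X} {deg : ι → ℕ}

/-- The maps whose components `gr_p → gr_q` vanish when `p - 2q < T`. -/
def IsSkew (S : Superfiltration R X) (T : ℤ) (f : X →ₗ[R] X) : Prop :=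
  ∀ p m : ℤ, p < T + 2 * (m + 1) → ∀ x ∈ S.F p, f x ∈ S.F m

theorem mem_of_forall_basis_F (hF : ∀ p x, x ∈ S.F p ↔ ∀ s, p < deg s → B.repr x s = 0)
    {p : ℤ} {x : X} (hx : x ∈ S.F p) {g : X →ₗ[R] X} {N : Submodule R X}
    (hg : ∀ s, (deg s : ℤ) ≤ p → g (B s) ∈ N) : g x ∈ N := by
  rw [← B.linearCombination_repr x, Finsupp.linearCombination_apply, Finsupp.sum, map_sum]
  refine sum_mem fun s _ => ?_
  rw [map_smul]
  rcases le_or_gt (deg s : ℤ) p with h | h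
  · exact Submodule.smul_mem _ _ (hg s h)
  · rw [(hF p x).1 hx s h, zero_smul]
    exact zero_mem _

theorem mem_of_forall_basis_G
    (hG : ∀ i x, x ∈ S.G i ↔ ∀ s, (deg s : ZMod 2) ≠ i → B.repr x s = 0)
    {i : ZMod 2} {x : X} (hx : x ∈ S.G i) {g : X →ₗ[R] X} {N : Submodule R X}
    (hg : ∀ s, (deg s : ZMod 2) = i → g (B s) ∈ N) : g x ∈ N := by
  rw [← B.linearCombination_repr x, Finsupp.linearCombination_apply, Finsupp.sum, map_sum]
  refine sum_mem fun s _ => ?_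
  rw [map_smul]
  by_cases h : (deg s : ZMod 2) = i
  · exact Submodule.smul_mem _ _ (hg s h)
  · rw [(hG i x).1 hx s h, zero_smul]
    exact zero_mem _

theorem basis_mem_F (hF : ∀ p x, x ∈ S.F p ↔ ∀ s, p < deg s → B.repr x s = 0) (s : ι) :
    B s ∈ S.F (deg s) := by
  classical
  refine (hF _ _).2 fun t ht => ?_
  rw [B.repr_self, Finsupp.single_apply, if_neg]
  rintro rfl
  simp at ht

theorem basis_mem_G (hG : ∀ i x, x ∈ S.G i ↔ ∀ s, (deg s : ZMod 2) ≠ i → B.repr x s = 0)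
    (s : ι) : B s ∈ S.G (deg s) := by
  classical
  refine (hG _ _).2 fun t ht => ?_
  rw [B.repr_self, Finsupp.single_apply, if_neg]
  rintro rfl
  simp at ht

variable {n : ℕ} {H : X →+ X} {K W D : X →ₗ[R] X}

/-- One correction of the lift: f is the defect, and replacing i by i + h changes it to f + d' h - h
d. Since f takes values below the top degree, f = K H f + H K f. The first part cancels against d'
h. The closedness of f rewrites K f in the second through W f, f K and f D, all of which improve the
weight once H is applied. -/
theorem isSkew_lift_step (hF : ∀ p x, x ∈ S.F p ↔ ∀ s, p < deg s → B.repr x s = 0)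
    (hn : S.F n = ⊤) (hH : ∀ p, ∀ x ∈ S.F p, H x ∈ S.F (p - 1))
    (hK : K ∈ (S.hom S).F 1) (hW : W ∈ (S.hom S).F (-1)) (hD : D ∈ (S.hom S).F (-1))
    (hKH : ∀ x ∈ S.F (n - 1), K (H x) + H (K x) = x) {T : ℤ} {f : X →ₗ[R] X}
    (hf : f ∈ (S.hom S).F (-1)) (hfd : (-(K + W)) ∘ₗ f + f ∘ₗ (-K + D) = 0)
    (hfT : IsSkew S T f) :
    IsSkew S (T + 1) (f + ((-(K + W)) ∘ₗ B.constr R (fun s => H (f (B s))) -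
      B.constr R (fun s => H (f (B s))) ∘ₗ (-K + D))) := by
  set h : X →ₗ[R] X := B.constr R (fun s => H (f (B s))) with hh
  have hB : ∀ s, h (B s) = H (f (B s)) := fun s => B.constr_basis _ _ _
  have hhT : IsSkew S (T + 2) h := fun p m hpm x hx => by
    refine mem_of_forall_basis_F hF hx fun s hs => ?_
    rw [hB]
    have := hH _ _ (hfT p (m + 1) (by lia) _ (S.mono hs (basis_mem_F hF s)))
    rwa [add_sub_cancel_right] at this
  intro p m hpm x hx
  refine mem_of_forall_basis_F hF hx fun s hs => ?_
  have hBs : B s ∈ S.F p := S.mono hs (basis_mem_F hF s)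
  have hKs : K (B s) ∈ S.F (p + 1) := hK _ _ hBs
  have hDs : D (B s) ∈ S.F p := S.mono (by lia) (hD _ _ hBs)
  have hH' : ∀ y ∈ S.F (m + 1), H y ∈ S.F m := fun y hy => by simpa using hH _ _ hy
  have hW' : ∀ y ∈ S.F (m + 1), W y ∈ S.F m := fun y hy => by simpa using hW _ _ hy
  have hW'' : ∀ y ∈ S.F (m + 2), W y ∈ S.F (m + 1) := fun y hy =>
    S.mono (by lia) (hW _ _ hy)
  have e1 := hKH (f (B s)) (hf n _ (hn ▸ Submodule.mem_top))
  have e2 : K (f (B s)) = -W (f (B s)) - f (K (B s)) + f (D (B s)) := by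
    have := LinearMap.congr_fun hfd (B s)
    simp only [LinearMap.add_apply, LinearMap.comp_apply, LinearMap.neg_apply, map_add, map_neg,
      LinearMap.zero_apply] at this
    rw [eq_comm, ← sub_eq_zero, ← this]
    abel
  have e3 : (f + ((-(K + W)) ∘ₗ h - h ∘ₗ (-K + D))) (B s) =
      -H (W (f (B s))) - H (f (K (B s))) + H (f (D (B s))) - W (H (f (B s))) + h (K (B s))
        - h (D (B s)) := by
    simp only [LinearMap.add_apply, LinearMap.comp_apply, LinearMap.neg_apply, LinearMap.sub_apply,
      map_add, map_neg, hB]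
    -- Only the leading summand f (B s) is split. Its part K (H (f (B s))) is what the K in d' h
    -- cancels.
    nth_rewrite 1 [← e1]
    rw [e2]
    simp only [map_add, map_sub, map_neg]
    abel
  rw [e3]
  -- Applying H or W to the output lowers q and gains two in p - 2q. Applying K to the input raises
  -- p and costs one, while D on the input costs nothing. The terms with K gain exactly the required
  -- one; the others gain at least two.
  refine sub_mem (add_mem (sub_mem (add_mem (sub_mem (neg_mem ?_) ?_) ?_) ?_) ?_) ?_
  · exact hH' _ (hW'' _ (hfT p _ (by lia) _ hBs))
  · exact hH' _ (hfT (p + 1) _ (by lia) _ hKs)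
  · exact hH' _ (hfT p _ (by lia) _ hDs)
  · exact hW' _ (hB s ▸ hhT p _ (by lia) _ hBs)
  · exact hhT (p + 1) _ (by lia) _ hKs
  · exact hhT p _ (by lia) _ hDs

/-- If the leading term of two odd endomorphisms with the same scalar square is minus a
differential `K` which is exact away from the top degree, then the identity lifts to a closed map
between them. -/
theorem exists_closed_lift (hF : ∀ p x, x ∈ S.F p ↔ ∀ s, p < deg s → B.repr x s = 0)
    (hG : ∀ i x, x ∈ S.G i ↔ ∀ s, (deg s : ZMod 2) ≠ i → B.repr x s = 0)
    (hn : S.F n = ⊤) (hbot : S.F (-1) = ⊥)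
    (hH : ∀ p, ∀ x ∈ S.F p, H x ∈ S.F (p - 1)) (hHG : ∀ i, ∀ x ∈ S.G i, H x ∈ S.G (i + 1))
    (hK : K ∈ (S.hom S).F 1) (hW : W ∈ (S.hom S).F (-1)) (hD : D ∈ (S.hom S).F (-1))
    (hKG : K ∈ (S.hom S).G 1) (hWG : W ∈ (S.hom S).G 1) (hDG : D ∈ (S.hom S).G 1)
    (hKH : ∀ x ∈ S.F (n - 1), K (H x) + H (K x) = x) {P : R}
    (hd' : (-(K + W)) ∘ₗ (-(K + W)) = P • LinearMap.id)
    (hd : (-K + D) ∘ₗ (-K + D) = P • LinearMap.id) :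
    ∃ i : X →ₗ[R] X, i ∈ (S.hom S).G 0 ∧ i - LinearMap.id ∈ (S.hom S).F (-2) ∧
      (-(K + W)) ∘ₗ i = i ∘ₗ (-K + D) := by
  have hd'F : -(K + W) ∈ (S.hom S).F 1 := neg_mem (add_mem hK ((S.hom S).mono (by lia) hW))
  have hdF : -K + D ∈ (S.hom S).F 1 := add_mem (neg_mem hK) ((S.hom S).mono (by lia) hD)
  have hd'G : -(K + W) ∈ (S.hom S).G 1 := neg_mem (add_mem hKG hWG)
  have hdG : -K + D ∈ (S.hom S).G 1 := add_mem (neg_mem hKG) hDG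
  -- After k corrections the components of the defect with p - 2q < k - n are gone.
  have key : ∀ k : ℕ, ∃ i : X →ₗ[R] X, i ∈ (S.hom S).G 0 ∧
      i - LinearMap.id ∈ (S.hom S).F (-2) ∧
      IsSkew S (-n + k) ((-(K + W)) ∘ₗ i - i ∘ₗ (-K + D)) := by
    have hdef : ∀ i : X →ₗ[R] X, i - LinearMap.id ∈ (S.hom S).F (-2) →
        (-(K + W)) ∘ₗ i - i ∘ₗ (-K + D) ∈ (S.hom S).F (-1) := fun i hi => by
      -- For the identity the two copies of K cancel, leaving the defect -W - D in degree -1. The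
      -- deviation of i from the identity has degree -2 and contributes in degree -1 as well.
      have : (-(K + W)) ∘ₗ i - i ∘ₗ (-K + D) = ((-(K + W)) ∘ₗ (i - LinearMap.id) -
          (i - LinearMap.id) ∘ₗ (-K + D)) + (-W - D) := by
        ext x
        simp
        abel
      rw [this]
      exact add_mem (sub_mem (comp_mem_F (by lia) hd'F hi) (comp_mem_F (by lia) hi hdF))
        (sub_mem (neg_mem hW) hD)
    intro k
    induction k with
    | zero =>
      have h0 : LinearMap.id - LinearMap.id ∈ (S.hom S).F (-2) := by
        rw [sub_self]
        exact zero_mem _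
      refine ⟨LinearMap.id, S.id_mem_G, h0, fun p m hpm x hx => ?_⟩
      -- Start of the induction: q ≤ n and q ≤ p already force p - 2q ≥ -n.
      rcases le_or_gt (n : ℤ) m with h | h
      · exact S.mono h (hn ▸ Submodule.mem_top)
      · refine S.mono ?_ (hdef _ h0 p x hx)
        lia
    | succ k ih =>
      obtain ⟨i, hiG, hiF, hiT⟩ := ih
      have hfF := hdef i hiF
      have hfG : (-(K + W)) ∘ₗ i - i ∘ₗ (-K + D) ∈ (S.hom S).G 1 :=
        sub_mem (comp_mem_G (by simp) hd'G hiG) (comp_mem_G (by simp) hiG hdG)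
      -- The mixed terms d' i d cancel, and d' d' i - i d d = 0 because both squares are the same
      -- scalar P.
      have hfd : (-(K + W)) ∘ₗ ((-(K + W)) ∘ₗ i - i ∘ₗ (-K + D)) +
          ((-(K + W)) ∘ₗ i - i ∘ₗ (-K + D)) ∘ₗ (-K + D) = 0 := by
        rw [LinearMap.comp_sub, LinearMap.sub_comp, ← LinearMap.comp_assoc, hd',
          LinearMap.comp_assoc _ _ i, hd, LinearMap.comp_assoc]
        ext x
        simp
      have hstep := isSkew_lift_step hF hn hH hK hW hD hKH hfF hfd hiT
      set f := (-(K + W)) ∘ₗ i - i ∘ₗ (-K + D) with hf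
      set h : X →ₗ[R] X := B.constr R (fun s => H (f (B s))) with hh
      have hB : ∀ s, h (B s) = H (f (B s)) := fun s => B.constr_basis _ _ _
      refine ⟨i + h, add_mem hiG fun j x hx => ?_, ?_, ?_⟩
      · refine mem_of_forall_basis_G hG hx fun s hs => ?_
        rw [hB]
        have := hHG _ _ (hfG _ _ (hs ▸ basis_mem_G hG s))
        rwa [add_assoc, CharTwo.add_self_eq_zero] at this
      · rw [add_sub_right_comm]
        refine add_mem hiF fun p x hx => ?_
        refine mem_of_forall_basis_F hF hx fun s hs => ?_
        rw [hB]
        have := hH _ _ (hfF _ _ (S.mono hs (basis_mem_F hF s)))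
        exact S.mono (by lia) this
      · have e : (-(K + W)) ∘ₗ (i + h) - (i + h) ∘ₗ (-K + D) =
            f + ((-(K + W)) ∘ₗ h - h ∘ₗ (-K + D)) := by
          rw [LinearMap.comp_add, LinearMap.add_comp, hf]
          abel
        rw [e]
        have e' : (-n + (k + 1 : ℕ) : ℤ) = -n + k + 1 := by push_cast; ring
        rwa [e']
  -- Degrees lie between 0 and n, so p - 2q ≤ n. Starting from -n, after 2n + 1 steps the bound is n
  -- + 1 and no component survives.
  obtain ⟨i, hiG, hiF, hiT⟩ := key (2 * n + 1)
  refine ⟨i, hiG, hiF, sub_eq_zero.1 (LinearMap.ext fun x => ?_)⟩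
  have := hiT n (-1) (by push_cast; lia) x (hn ▸ Submodule.mem_top)
  rw [hbot] at this
  exact this

theorem pow_mem_F {N : Module.End R X} (hN : N ∈ (S.hom S).F (-1)) (k : ℕ) :
    N ^ k ∈ (S.hom S).F (-k) := by
  induction k with
  | zero => exact fun p x hx => by simpa using hx
  | succ k ih =>
    rw [pow_succ, Module.End.mul_eq_comp]
    exact comp_mem_F (by lia) ih hN

theorem pow_mem_G {N : Module.End R X} (hN : N ∈ (S.hom S).G 0) (k : ℕ) :
    N ^ k ∈ (S.hom S).G 0 := by
  induction k with
  | zero => exact S.id_mem_G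
  | succ k ih =>
    rw [pow_succ, Module.End.mul_eq_comp]
    exact comp_mem_G (i := 0) (j := 0) (by simp) ih hN

/-- An even map which is the identity up to lower order terms is invertible, and so is its
inverse. -/
theorem exists_unipotent_inverse (hn : S.F n = ⊤) (hbot : S.F (-1) = ⊥) {i : Module.End R X}
    (hiG : i ∈ (S.hom S).G 0) (hiF : i - LinearMap.id ∈ (S.hom S).F (-1)) :
    ∃ j : Module.End R X, j ∈ (S.hom S).G 0 ∧ j - LinearMap.id ∈ (S.hom S).F (-1) ∧
      i * j = 1 ∧ j * i = 1 := by
  set N : Module.End R X := 1 - i with hN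
  have hNF : N ∈ (S.hom S).F (-1) := by
    have : N = -(i - LinearMap.id) := (neg_sub i (1 : Module.End R X)).symm
    rw [this]
    exact neg_mem hiF
  have hNG : N ∈ (S.hom S).G 0 := sub_mem S.id_mem_G hiG
  -- Each factor lowers the filtration by one, and n + 1 of them lead from F^n, which is everything,
  -- to F^{-1} = 0.
  have hnil : N ^ (n + 1) = 0 := by
    refine LinearMap.ext fun x => ?_
    have := pow_mem_F hNF (n + 1) n x (hn ▸ Submodule.mem_top)
    rw [show (n + -((n + 1 : ℕ) : ℤ)) = -1 by push_cast; ring, hbot] at this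
    exact this
  have hi : i = 1 - N := (sub_sub_cancel _ _).symm
  have h1 : i * ∑ k ∈ Finset.range (n + 1), N ^ k = 1 := by
    rw [hi, mul_neg_geom_sum, hnil, sub_zero]
  have h2 : (∑ k ∈ Finset.range (n + 1), N ^ k) * i = 1 := by
    rw [hi, geom_sum_mul_neg, hnil, sub_zero]
  refine ⟨∑ k ∈ Finset.range (n + 1), N ^ k, sum_mem fun k _ => pow_mem_G hNG k, ?_, h1, h2⟩
  rw [Finset.sum_range_succ', pow_zero]
  have e : ∑ k ∈ Finset.range n, N ^ (k + 1) + 1 - LinearMap.id =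
      ∑ k ∈ Finset.range n, N ^ (k + 1) := add_sub_cancel_right _ (1 : Module.End R X)
  rw [e]
  exact sum_mem fun k _ => (S.hom S).mono (by push_cast; lia) (pow_mem_F hNF (k + 1))

end Lifting

end SuperMF

/-! ### The Clifford relation and the Koszul matrix factorisation. -/

namespace SuperMF

open Superfiltration

/-- Cross terms cancel in pairs. The squares are assumed to vanish separately, because 2 need not be
invertible and anticommutation alone does not give it. -/
theorem sum_mul_self_of_anticomm {R A ι : Type*} [CommRing R] [Ring A] [Algebra R A] (s : Finset ι)
    (x : ι → R) {v : ι → A} (hv : ∀ i, v i * v i = 0) (hvv : ∀ i j, v i * v j = -(v j * v i)) :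
    (∑ i ∈ s, x i • v i) * (∑ i ∈ s, x i • v i) = 0 := by
  classical
  induction s using Finset.induction_on with
  | empty => simp
  | insert j s hj ih =>
    have h : x j • v j * (∑ i ∈ s, x i • v i) = -((∑ i ∈ s, x i • v i) * x j • v j) := by
      rw [Finset.mul_sum, Finset.sum_mul, ← Finset.sum_neg_distrib]
      refine Finset.sum_congr rfl fun i _ => ?_
      rw [smul_mul_smul_comm, smul_mul_smul_comm, hvv j i, smul_neg, mul_comm]
    rw [Finset.sum_insert hj, add_mul, mul_add, mul_add, ih, h, smul_mul_smul_comm, hv, smul_zero]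
    abel

/-- The Clifford relation for the square of `x + w` with `x ∈ V`, `w ∈ V^∨`. -/
theorem clifford_mul_self {R A ι : Type*} [CommRing R] [Ring A] [Algebra R A] [Fintype ι]
    [DecidableEq ι] (x w : ι → R) {v c : ι → A} (hv : ∀ i, v i * v i = 0)
    (hvv : ∀ i j, v i * v j = -(v j * v i)) (hc : ∀ i, c i * c i = 0)
    (hcc : ∀ i j, c i * c j = -(c j * c i))
    (hcv : ∀ i j, c i * v j + v j * c i = if i = j then 1 else 0) :
    (∑ i, x i • v i + ∑ i, w i • c i) * (∑ i, x i • v i + ∑ i, w i • c i) =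
      (∑ i, x i * w i) • (1 : A) := by
  have h : (∑ i, w i • c i) * (∑ i, x i • v i) + (∑ i, x i • v i) * (∑ i, w i • c i) =
      (∑ i, x i * w i) • (1 : A) := by
    rw [Finset.sum_mul_sum, Finset.sum_mul_sum, Finset.sum_comm, ← Finset.sum_add_distrib,
      Finset.sum_smul]
    refine Finset.sum_congr rfl fun j _ => ?_
    rw [← Finset.sum_add_distrib]
    have : ∀ i, w i • c i * x j • v j + x j • v j * w i • c i =
        if i = j then (x j * w i) • (1 : A) else 0 := fun i => by
      rw [smul_mul_smul_comm, smul_mul_smul_comm, mul_comm (w i), ← smul_add, hcv]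
      split_ifs <;> simp
    simp only [this, Finset.sum_ite_eq', Finset.mem_univ, if_true]
  rw [add_mul, mul_add, mul_add, sum_mul_self_of_anticomm _ x hv hvv,
    sum_mul_self_of_anticomm _ w hc hcc, ← h]
  abel

section Generic

variable {R X : Type*} [CommRing R] [AddCommGroup X] [Module R X] {S : Superfiltration R X}

theorem neg_comp_neg (f : X →ₗ[R] X) : (-f) ∘ₗ (-f) = f ∘ₗ f := by
  rw [LinearMap.neg_comp, LinearMap.comp_neg, neg_neg]

theorem neg_add_isSuperfiltered {K W : X →ₗ[R] X} (hK : K ∈ (S.hom S).F 1)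
    (hW : W ∈ (S.hom S).F (-1)) (hKG : K ∈ (S.hom S).G 1) (hWG : W ∈ (S.hom S).G 1) :
    S.IsSuperfiltered S 1 (-(K + W)) := by
  refine ⟨?_, neg_mem (add_mem hK ((S.hom S).mono (by lia) hW))⟩
  rw [Int.cast_one]
  exact neg_mem (add_mem hKG hWG)

end Generic

section Exterior

variable {R₀ : Type u} [CommRing R₀] {V : Type v} [AddCommGroup V] [Module R₀ V] {n : ℕ}
  (b : Module.Basis (Fin n) R₀ V)

/-- The `R`-linear extension of an endomorphism of `E`. -/
noncomputable def extend (n : ℕ) (f : Module.End R₀ (ExteriorAlgebra R₀ V)) :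
    Module.End (FormalRing R₀ n) (ExtR R₀ V n) :=
  LinearMap.baseChange (FormalRing R₀ n) f

theorem extend_tmul (f : Module.End R₀ (ExteriorAlgebra R₀ V)) (r : FormalRing R₀ n)
    (a : ExteriorAlgebra R₀ V) : extend n f (r ⊗ₜ a) = r ⊗ₜ f a := rfl

theorem extend_mul (f g : Module.End R₀ (ExteriorAlgebra R₀ V)) :
    extend n (f * g) = extend n f * extend n g := LinearMap.baseChange_comp _ _

theorem extend_zero : extend n (0 : Module.End R₀ (ExteriorAlgebra R₀ V)) = 0 :=
  LinearMap.baseChange_zero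

theorem extend_one : extend n (1 : Module.End R₀ (ExteriorAlgebra R₀ V)) = 1 :=
  LinearMap.baseChange_id

theorem extend_neg (f : Module.End R₀ (ExteriorAlgebra R₀ V)) : extend n (-f) = -extend n f :=
  LinearMap.baseChange_neg f

theorem extend_add (f g : Module.End R₀ (ExteriorAlgebra R₀ V)) :
    extend n (f + g) = extend n f + extend n g := LinearMap.baseChange_add f g

theorem extend_mem_F (b : Module.Basis (Fin n) R₀ V) {p : ℤ} {f : Module.End R₀ (ExteriorAlgebra R₀ V)}
    (hf : f ∈ ((extSF R₀ V).hom (extSF R₀ V)).F p) : extend n f ∈ (endSF R₀ V n).F p :=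
  fun _ _ hx => map_mem_extRSF_F b LinearMap.id hf hx

theorem extend_mem_G (b : Module.Basis (Fin n) R₀ V) {i : ZMod 2} {f : Module.End R₀ (ExteriorAlgebra R₀ V)}
    (hf : f ∈ ((extSF R₀ V).hom (extSF R₀ V)).G i) : extend n f ∈ (endSF R₀ V n).G i :=
  fun _ _ hx => map_mem_extRSF_G b LinearMap.id hf hx

/-- Left multiplication by `v = ∑ x_i v_i`. -/
noncomputable def koszulV : Module.End (FormalRing R₀ n) (ExtR R₀ V n) :=
  ∑ i, (MvPowerSeries.X i : FormalRing R₀ n) • extend n (wedge b i)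

/-- Contraction with `w = ∑ w_i v_i^∨`. -/
noncomputable def koszulW (w : Fin n → FormalRing R₀ n) :
    Module.End (FormalRing R₀ n) (ExtR R₀ V n) :=
  ∑ i, w i • extend n (contract b i)

theorem koszulV_apply (x : ExtR R₀ V n) : koszulV b x = canonicalV b * x := by
  rw [← sum_koszulTerm_apply, koszulV, LinearMap.sum_apply, LinearMap.sum_apply]
  refine Finset.sum_congr rfl fun i _ => ?_
  induction x using TensorProduct.induction_on with
  | zero => rw [map_zero, map_zero]
  | add x y hx hy => rw [map_add, map_add, hx, hy]
  | tmul r a => rfl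

theorem koszulD_eq (w : Fin n → FormalRing R₀ n) :
    koszulD b w = -(koszulV b + koszulW b w) := by
  have : LinearMap.mulLeft (FormalRing R₀ n) (canonicalV b) = koszulV b :=
    LinearMap.ext fun x => (koszulV_apply b x).symm
  rw [← this]
  rfl

theorem koszulV_mem_F : koszulV b ∈ (endSF R₀ V n).F 1 :=
  sum_mem fun i _ => Submodule.smul_mem _ _ (extend_mem_F b (wedge_mem_F b i))

theorem koszulV_mem_G : koszulV b ∈ (endSF R₀ V n).G 1 :=
  sum_mem fun i _ => Submodule.smul_mem _ _ (extend_mem_G b (wedge_mem_G b i))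

theorem koszulW_mem_F (w : Fin n → FormalRing R₀ n) : koszulW b w ∈ (endSF R₀ V n).F (-1) :=
  sum_mem fun i _ => Submodule.smul_mem _ _ (extend_mem_F b (contract_mem_F b i))

theorem koszulW_mem_G (w : Fin n → FormalRing R₀ n) : koszulW b w ∈ (endSF R₀ V n).G 1 :=
  sum_mem fun i _ => Submodule.smul_mem _ _ (extend_mem_G b (contract_mem_G b i))

theorem koszulD_mul_self (w : Fin n → FormalRing R₀ n) :
    koszulD b w ∘ₗ koszulD b w = (∑ i, MvPowerSeries.X i * w i) • LinearMap.id := by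
  rw [koszulD_eq]
  refine (neg_comp_neg _).trans <| clifford_mul_self (A := Module.End (FormalRing R₀ n) (ExtR R₀ V n)) _ w ?_ ?_ ?_ ?_ ?_
  · intro i
    rw [← extend_mul, wedge_mul_self, extend_zero]
  · intro i j
    rw [← extend_mul, wedge_mul_wedge, extend_neg, extend_mul]
  · intro i
    rw [← extend_mul, contract_mul_self, extend_zero]
  · intro i j
    rw [← extend_mul, contract_mul_contract, extend_neg, extend_mul]
  · intro i j
    have h : contract b i * wedge b j + wedge b j * contract b i = if i = j then 1 else 0 := by
      rw [contract_mul_wedge, sub_add_cancel]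
    rw [← extend_mul, ← extend_mul]
    refine (extend_add (n := n) (contract b i * wedge b j) (wedge b j * contract b i)).symm.trans ?_
    rw [h]
    split_ifs
    · exact extend_one
    · exact extend_zero

theorem koszulD_isFilteredMF {P : FormalRing R₀ n} {w : Fin n → FormalRing R₀ n}
    (hw : ∑ i, MvPowerSeries.X i * w i = P) : IsFilteredMF (extRSF R₀ V n) P (koszulD b w) where
  free := Module.Free.of_basis (extRBasis b)
  finite := Module.Finite.of_basis (extRBasis b)
  superfiltered := koszulD_eq b w ▸ neg_add_isSuperfiltered (koszulV_mem_F b) (koszulW_mem_F b w)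
    (koszulV_mem_G b) (koszulW_mem_G b w)
  square := hw ▸ koszulD_mul_self b w

end Exterior

end SuperMF

/-! ### Words in the basis vectors and the coefficients of the operations. -/

namespace SuperMF

open Superfiltration

section Words

variable {n : ℕ}

/-- The words of length `k` with `x_{i_1} ⋯ x_{i_k} = x^m`. -/
noncomputable def wordsOf (k : ℕ) (m : Fin n →₀ ℕ) : Finset (Fin k → Fin n) :=
  {i | ∑ t, Finsupp.single (i t) 1 = m}

theorem mem_wordsOf {k : ℕ} {m : Fin n →₀ ℕ} {i : Fin k → Fin n} :
    i ∈ wordsOf k m ↔ ∑ t, Finsupp.single (i t) 1 = m := by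
  simp [wordsOf]

theorem degree_of_mem_wordsOf {k : ℕ} {m : Fin n →₀ ℕ} {i : Fin k → Fin n}
    (h : i ∈ wordsOf k m) : m.degree = k := by
  rw [← mem_wordsOf.1 h, map_sum]
  simp

/-- The length is a parameter independent of the monomial, so that words can be cut and joined
freely. Sums over all lengths collapse by this vanishing. -/
theorem wordsOf_eq_empty {k : ℕ} {m : Fin n →₀ ℕ} (h : m.degree ≠ k) : wordsOf k m = ∅ :=
  Finset.eq_empty_of_forall_notMem fun _ hi => h (degree_of_mem_wordsOf hi)

/-- Cutting a word after k letters factors its monomial. This matches blocks of inputs in the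
A∞-relations with Cauchy products of power series. -/
theorem sum_wordsOf_add {M : Type*} [AddCommMonoid M] (k l : ℕ) (m : Fin n →₀ ℕ)
    (f : (Fin (k + l) → Fin n) → M) :
    ∑ w ∈ wordsOf (k + l) m, f w =
      ∑ p ∈ Finset.HasAntidiagonal.antidiagonal m, ∑ w₁ ∈ wordsOf k p.1, ∑ w₂ ∈ wordsOf l p.2,
        f (Fin.append w₁ w₂) := by
  classical
  let c : ∀ {j : ℕ}, (Fin j → Fin n) → (Fin n →₀ ℕ) := fun w => ∑ t, Finsupp.single (w t) 1
  have hc : ∀ {j : ℕ} (p : Fin n →₀ ℕ) (g : (Fin j → Fin n) → M),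
      ∑ w ∈ wordsOf j p, g w = ∑ w, if c w = p then g w else 0 := fun p g => Finset.sum_filter _ _
  simp only [hc]
  rw [← (Fin.appendEquiv k l).sum_comp, Fintype.sum_prod_type, Finset.sum_comm]
  conv_rhs => rw [Finset.sum_comm]
  rw [Finset.sum_comm]
  refine Finset.sum_congr rfl fun w₁ _ => ?_
  have : ∀ p : (Fin n →₀ ℕ) × (Fin n →₀ ℕ),
      (if c w₁ = p.1 then ∑ w₂, if c w₂ = p.2 then f (Fin.append w₁ w₂) else 0 else 0) =
        ∑ w₂, if (c w₁, c w₂) = p then f (Fin.append w₁ w₂) else 0 := fun p => by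
    split_ifs with h
    · simp only [Prod.ext_iff, h, true_and]
    · simp only [Prod.ext_iff, h, false_and, if_false, Finset.sum_const_zero]
  simp only [this]
  rw [Finset.sum_comm]
  refine Finset.sum_congr rfl fun w₂ _ => ?_
  rw [Finset.sum_ite_eq]
  simp [Fin.appendEquiv, Fin.sum_univ_add, c]

end Words

section Exterior

variable {R₀ : Type u} [CommRing R₀] {V : Type v} [AddCommGroup V] [Module R₀ V] {n : ℕ}
  (b : Module.Basis (Fin n) R₀ V)

/-- Among the monomials only the empty one has degree at most 0, and it is a scalar. -/
theorem eq_algebraMap_of_mem_F (b : Module.Basis (Fin n) R₀ V) {x : ExteriorAlgebra R₀ V} (hx : x ∈ (extSF R₀ V).F 0) :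
    x = algebraMap R₀ _ (ExteriorAlgebra.algebraMapInv x) := by
  obtain ⟨r, hr⟩ : ∃ r : R₀, algebraMap R₀ _ r = b.ExteriorAlgebra ∅ :=
    Submodule.mem_one.1 (by simpa using basis_mem_degree b ∅)
  have h : x = algebraMap R₀ _ (b.ExteriorAlgebra.repr x ∅ * r) := by
    rw [map_mul, hr, ← Algebra.smul_def]
    conv_lhs => rw [← b.ExteriorAlgebra.sum_repr x]
    refine Finset.sum_eq_single_of_mem _ (Finset.mem_univ _) fun s _ hs => ?_
    rw [(mem_extSF_F b).1 hx s (by simpa [Finset.card_pos] using Finset.nonempty_iff_ne_empty.2 hs),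
      zero_smul]
  rw [h, ExteriorAlgebra.algebraMap_leftInverse]

theorem ι_mem_degree (v : V) : ExteriorAlgebra.ι R₀ v ∈ ⋀[R₀]^1 V := by
  simp

theorem ι_mem_F (v : V) : ExteriorAlgebra.ι R₀ v ∈ (extSF R₀ V).F 1 :=
  mem_F_of_mem_degree (𝒜 := fun q : ℕ => ⋀[R₀]^q V) (q := 1) (by simp) (ι_mem_degree v)

theorem ι_mem_G (v : V) : ExteriorAlgebra.ι R₀ v ∈ (extSF R₀ V).G 1 :=
  mem_G_of_mem_degree (𝒜 := fun q : ℕ => ⋀[R₀]^q V) (q := 1) (by simp) (ι_mem_degree v)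

theorem mul_ι_of_mem_degree (v : V) {q : ℕ} {x : ExteriorAlgebra R₀ V} (hx : x ∈ ⋀[R₀]^q V) :
    x * ExteriorAlgebra.ι R₀ v = (-1 : ℤ) ^ q • (ExteriorAlgebra.ι R₀ v * x) := by
  induction hx using Submodule.pow_induction_on_left' with
  | algebraMap r => simp [Algebra.commutes]
  | add x y q hx hy ihx ihy => rw [add_mul, ihx, ihy, mul_add, smul_add]
  | mem_mul m hm q x hx ih =>
    obtain ⟨m, rfl⟩ := hm
    rw [mul_assoc, ih, mul_smul_comm, ← mul_assoc, ← mul_assoc,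
      eq_neg_of_add_eq_zero_left (ExteriorAlgebra.ι_add_mul_swap m v), pow_succ, mul_neg_one,
      neg_smul, neg_mul, smul_neg]

/-- The letters of a word, followed by `a`. -/
noncomputable def wordSeq {k : ℕ} (w : Fin k → Fin n) (a : ExteriorAlgebra R₀ V) (t : ℕ) :
    ExteriorAlgebra R₀ V :=
  -- All positions from k on carry a, since the A∞-relations are stated for sequences indexed by ℕ.
  if h : t < k then ExteriorAlgebra.ι R₀ (b (w ⟨t, h⟩)) else a

theorem snoc_eq_wordSeq {k : ℕ} (w : Fin k → Fin n) (a : ExteriorAlgebra R₀ V) :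
    (Fin.snoc (fun t => ExteriorAlgebra.ι R₀ (b (w t))) a : Fin (k + 1) → ExteriorAlgebra R₀ V) =
      fun t : Fin (k + 1) => wordSeq b w a t := by
  funext t
  refine Fin.lastCases ?_ (fun t => ?_) t
  · simp [wordSeq]
  · simp [wordSeq]

theorem wordSeq_mem_F {k : ℕ} (w : Fin k → Fin n) {a : ExteriorAlgebra R₀ V} {p : ℤ}
    (ha : a ∈ (extSF R₀ V).F p) (t : ℕ) :
    wordSeq b w a t ∈ (extSF R₀ V).F (if t < k then 1 else p) := by
  rw [wordSeq]
  split_ifs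
  · exact ι_mem_F _
  · exact ha

theorem wordSeq_mem_G {k : ℕ} (w : Fin k → Fin n) {a : ExteriorAlgebra R₀ V} {p : ZMod 2}
    (ha : a ∈ (extSF R₀ V).G p) (t : ℕ) :
    wordSeq b w a t ∈ (extSF R₀ V).G (if t < k then 1 else p) := by
  rw [wordSeq]
  split_ifs
  · exact ι_mem_G _
  · exact ha

/-- The coefficient of `x^m` in `∑ μ^{1+k}(a, v, …, v)`. -/
noncomputable def insertCoeff
    (μ : Ops R₀ (ExteriorAlgebra R₀ V) (ExteriorAlgebra R₀ V)) (k : ℕ) (m : Fin n →₀ ℕ) :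
    Module.End R₀ (ExteriorAlgebra R₀ V) where
  toFun a := ∑ w ∈ wordsOf k m, μ (k + 1) (Fin.snoc (fun t => ExteriorAlgebra.ι R₀ (b (w t))) a)
  map_add' a a' := by simp only [← Finset.sum_add_distrib, MultilinearMap.snoc_add]
  map_smul' r a := by simp only [RingHom.id_apply, Finset.smul_sum, MultilinearMap.snoc_smul]

theorem insertCoeff_apply (μ : Ops R₀ (ExteriorAlgebra R₀ V) (ExteriorAlgebra R₀ V)) (k : ℕ)
    (m : Fin n →₀ ℕ) (a : ExteriorAlgebra R₀ V) : insertCoeff b μ k m a =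
      ∑ w ∈ wordsOf k m, μ (k + 1) (fun t => wordSeq b w a t) :=
  Finset.sum_congr rfl fun w _ => congrArg _ (snoc_eq_wordSeq b w a)

/-- Vectors of V have level 0 in E[1], so inserting any number of them does not change the shift. -/
theorem insertCoeff_mem_F {μ : Ops R₀ (ExteriorAlgebra R₀ V) (ExteriorAlgebra R₀ V)} {r : ℤ}
    (hμ : ∀ k, ShiftedFiltered (extSF R₀ V) (extSF R₀ V) r (μ k)) (k : ℕ) (m : Fin n →₀ ℕ) :
    insertCoeff b μ k m ∈ ((extSF R₀ V).hom (extSF R₀ V)).F r := fun p a ha => by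
  rw [insertCoeff_apply]
  refine sum_mem fun w _ => ?_
  have := hμ (k + 1) (fun t => if (t : ℕ) < k then 1 else p) _ fun t => wordSeq_mem_F b w ha t
  rw [Fin.sum_univ_castSucc] at this
  simpa using this

theorem insertCoeff_mem_G {μ : Ops R₀ (ExteriorAlgebra R₀ V) (ExteriorAlgebra R₀ V)} {r : ℤ}
    (hμ : ∀ k, ShiftedDegree (extSF R₀ V) (extSF R₀ V) r (μ k)) (k : ℕ) (m : Fin n →₀ ℕ) :
    insertCoeff b μ k m ∈ ((extSF R₀ V).hom (extSF R₀ V)).G r := fun p a ha => by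
  obtain ⟨p, rfl⟩ := ZMod.intCast_surjective p
  rw [insertCoeff_apply]
  refine sum_mem fun w _ => ?_
  have := hμ (k + 1) (fun t => if (t : ℕ) < k then 1 else p) _ fun t => by
    have := wordSeq_mem_G b w ha t
    split_ifs with h
    · simpa [h] using this
    · simpa [h] using this
  rw [Fin.sum_univ_castSucc] at this
  simpa using this

/-- The coefficient of `x^m` in `μ^k(v, …, v)`. -/
noncomputable def potentialCoeff
    (μ : Ops R₀ (ExteriorAlgebra R₀ V) (ExteriorAlgebra R₀ V)) (k : ℕ) (m : Fin n →₀ ℕ) :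
    ExteriorAlgebra R₀ V :=
  ∑ w ∈ wordsOf k m, μ k (fun t => ExteriorAlgebra.ι R₀ (b (w t)))

variable (A : SuperfilteredDeformation R₀ V)

/-- Exchanging the two letters preserves the monomial and reverses the sign of the product. A word
fixed by the exchange contributes a square, which is zero. -/
theorem sum_wordsOf_two (m : Fin n →₀ ℕ) :
    ∑ w ∈ wordsOf 2 m, ExteriorAlgebra.ι R₀ (b (w 1)) * ExteriorAlgebra.ι R₀ (b (w 0)) = 0 := by
  refine Finset.sum_involution (fun w _ => w ∘ Equiv.swap 0 1) ?_ ?_ ?_ ?_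
  · intro w _
    simp
  · intro w _ h h'
    refine h ?_
    have : w 1 = w 0 := by simpa using congrFun h' 0
    rw [this, ExteriorAlgebra.ι_sq_zero]
  · intro w hw
    rw [mem_wordsOf] at hw ⊢
    rw [← hw]
    exact Equiv.sum_comp (Equiv.swap (0 : Fin 2) 1) fun t => (Finsupp.single (w t) 1 : Fin n →₀ ℕ)
  · intro w _
    funext t
    simp

/-- The formal part of the sum vanishes, for k = 2 by antisymmetry over words. The remainder lies in
F^1 and is even, hence lies in F^0. A single μ^2(v_i, v_j) need not lie there: the sum over words is
essential. -/
theorem potentialCoeff_mem_F (k : ℕ) (m : Fin n →₀ ℕ) :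
    potentialCoeff b A.μ k m ∈ (extSF R₀ V).F 0 := by
  match k with
  | 0 =>
    rw [potentialCoeff, A.isAInfinity.curvature]
    simp
  | 1 =>
    rw [potentialCoeff, A.minimal]
    simp
  | k + 2 =>
    refine mem_F_of_mem_G _ ?_ ?_
    · rw [zero_add]
      have key : ∀ w : Fin (k + 2) → Fin n, (A.μ (k + 2) - dgOps (extSF R₀ V)
          (LinearMap.mul R₀ (ExteriorAlgebra R₀ V)) 0 (k + 2))
            (fun t => ExteriorAlgebra.ι R₀ (b (w t))) ∈ (extSF R₀ V).F 1 := fun w => by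
        simpa using A.leading (k + 2) (fun _ => 1) _ fun t => ι_mem_F (b (w t))
      have key' : ∑ w ∈ wordsOf (k + 2) m, dgOps (extSF R₀ V)
          (LinearMap.mul R₀ (ExteriorAlgebra R₀ V)) 0 (k + 2)
            (fun t => ExteriorAlgebra.ι R₀ (b (w t))) = 0 := by
        match k with
        | 0 =>
          rw [← neg_eq_zero, ← Finset.sum_neg_distrib, ← sum_wordsOf_two b m]
          refine Finset.sum_congr rfl fun w _ => ?_
          change -(ExteriorAlgebra.ι R₀ (b (w 1)) *
            (extSF R₀ V).sign (ExteriorAlgebra.ι R₀ (b (w 0)))) = _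
          rw [sign_odd _ (ι_mem_G _), mul_neg, neg_neg]
        | k + 1 => exact Finset.sum_eq_zero fun w _ => rfl
      have := sum_mem (t := wordsOf (k + 2) m) fun w _ => key w
      simp only [sub_apply, Finset.sum_sub_distrib, key', sub_zero] at this
      exact this
    · refine sum_mem fun w _ => ?_
      have := A.isAInfinity.degree (k + 2) (fun _ => 1) (fun t => ExteriorAlgebra.ι R₀ (b (w t)))
        fun t => by simpa using ι_mem_G (b (w t))
      simp only [sub_self, Finset.sum_const_zero, zero_add, Int.cast_add, Int.cast_one] at this
      exact this

theorem potentialCoeff_eq (k : ℕ) (m : Fin n →₀ ℕ) : potentialCoeff b A.μ k m =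
    algebraMap R₀ _ (ExteriorAlgebra.algebraMapInv (potentialCoeff b A.μ k m)) :=
  eq_algebraMap_of_mem_F b (potentialCoeff_mem_F b A k m)

theorem coeff_discPotential (m : Fin n →₀ ℕ) : MvPowerSeries.coeff m (discPotential b A) =
    ExteriorAlgebra.algebraMapInv (potentialCoeff b A.μ m.degree m) := rfl

end Exterior

end SuperMF

/-! ### The A∞-relations with inputs (a, v, …, v) and the square of the mirror operation. -/

namespace SuperMF

open Superfiltration

section Exterior

variable {R₀ : Type u} [CommRing R₀] {V : Type v} [AddCommGroup V] [Module R₀ V] {n : ℕ}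
  (b : Module.Basis (Fin n) R₀ V) (A : SuperfilteredDeformation R₀ V)

/-- The summand of the `A_∞`-relation with `k` inputs in which `μ^j` is inserted at place `i`. -/
def insertionTerm (μ : Ops R₀ (ExteriorAlgebra R₀ V) (ExteriorAlgebra R₀ V)) (k j i : ℕ)
    (a : ℕ → ExteriorAlgebra R₀ V) : ExteriorAlgebra R₀ V :=
  μ (k - j + 1) (fun t => if (t : ℕ) < i then a t
    else if (t : ℕ) = i then μ j (fun s => a (i + s)) else a (t + j - 1))

theorem wordSeq_append_left {i l : ℕ} (w₁ : Fin i → Fin n) (w₂ : Fin l → Fin n)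
    (a c : ExteriorAlgebra R₀ V) {t : ℕ} (ht : t < i) :
    wordSeq b (Fin.append w₁ w₂) a t = wordSeq b w₁ c t := by
  rw [wordSeq, wordSeq, dif_pos (by lia), dif_pos ht]
  congr 2
  exact Fin.append_left w₁ w₂ ⟨t, ht⟩

theorem wordSeq_append_right {i l : ℕ} (w₁ : Fin i → Fin n) (w₂ : Fin l → Fin n)
    (a : ExteriorAlgebra R₀ V) (t : ℕ) :
    wordSeq b (Fin.append w₁ w₂) a (i + t) = wordSeq b w₂ a t := by
  by_cases ht : t < l
  · rw [wordSeq, wordSeq, dif_pos (by lia), dif_pos ht]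
    congr 2
    exact Fin.append_right w₁ w₂ ⟨t, ht⟩
  · rw [wordSeq, wordSeq, dif_neg (by lia), dif_neg ht]

theorem wordSeq_of_lt {k : ℕ} (w : Fin k → Fin n) (a : ExteriorAlgebra R₀ V) (t : Fin k) :
    wordSeq b w a t = ExteriorAlgebra.ι R₀ (b (w t)) := dif_pos t.2

/-- The inner block reaches the end and contains a, so the outer operation receives i letters
followed by the inner output. -/
theorem sum_insertionTerm_last (μ : Ops R₀ (ExteriorAlgebra R₀ V) (ExteriorAlgebra R₀ V))
    (i l : ℕ) (m : Fin n →₀ ℕ) (a : ExteriorAlgebra R₀ V) :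
    ∑ w ∈ wordsOf (i + l) m, insertionTerm μ (i + l + 1) (l + 1) i (wordSeq b w a) =
      ∑ p ∈ Finset.HasAntidiagonal.antidiagonal m,
        insertCoeff b μ i p.1 (insertCoeff b μ l p.2 a) := by
  rw [sum_wordsOf_add]
  refine Finset.sum_congr rfl fun p _ => ?_
  rw [insertCoeff_apply b μ l, map_sum, Finset.sum_comm]
  refine Finset.sum_congr rfl fun w₂ _ => ?_
  rw [insertCoeff_apply]
  refine Finset.sum_congr rfl fun w₁ _ => ?_
  rw [insertionTerm, show i + l + 1 - (l + 1) + 1 = i + 1 by lia]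
  congr 1
  funext t
  simp only [wordSeq_append_right]
  split_ifs with h1 h2
  · exact wordSeq_append_left b w₁ w₂ _ _ h1
  · rw [wordSeq, dif_neg h1]
  · exact absurd t.2 (by lia)

/-- Here the inner block consists of letters only. Summed over the inner word, its output is a
multiple of the unit, and the outer operation has i + l + 2 ≥ 3 inputs, so strict unitality kills
it. -/
theorem sum_insertionTerm_middle {i j l : ℕ} (hj : 1 ≤ j) (hil : 1 ≤ i + l) (m : Fin n →₀ ℕ)
    (a : ExteriorAlgebra R₀ V) :
    ∑ w ∈ wordsOf (i + j + l) m, insertionTerm A.μ (i + j + l + 1) j i (wordSeq b w a) = 0 := by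
  rw [sum_wordsOf_add]
  refine Finset.sum_eq_zero fun p _ => ?_
  rw [sum_wordsOf_add]
  refine Finset.sum_eq_zero fun q _ => Finset.sum_eq_zero fun w₁ _ => ?_
  rw [Finset.sum_comm]
  refine Finset.sum_eq_zero fun w₃ _ => ?_
  have key : ∀ w₂ : Fin j → Fin n, insertionTerm A.μ (i + j + l + 1) j i
      (wordSeq b (Fin.append (Fin.append w₁ w₂) w₃) a) =
      A.μ (i + j + l + 1 - j + 1) (Function.update
        (fun t => if (t : ℕ) < i then wordSeq b w₁ a t else wordSeq b w₃ a (t - i - 1))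
        ⟨i, by lia⟩ (A.μ j fun s => ExteriorAlgebra.ι R₀ (b (w₂ s)))) := by
    intro w₂
    rw [insertionTerm]
    congr 1
    funext t
    split_ifs with h1 h2
    · rw [Function.update_of_ne (by rintro rfl; simp at h1), if_pos h1,
        wordSeq_append_left b _ _ _ a (by lia), wordSeq_append_left b _ _ _ a h1]
    · have ht : t = ⟨i, by lia⟩ := Fin.ext h2
      rw [ht, Function.update_self]
      congr 1
      funext s
      rw [wordSeq_append_left b _ _ _ a (by lia), wordSeq_append_right, wordSeq_of_lt]
    · rw [Function.update_of_ne (by rintro rfl; exact h2 rfl), if_neg h1,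
        show (t : ℕ) + j - 1 = i + j + (t - i - 1) by lia, wordSeq_append_right]
  rw [Finset.sum_congr rfl fun w₂ _ => key w₂, ← MultilinearMap.map_update_sum]
  change A.μ _ (Function.update _ _ (potentialCoeff b A.μ j q.2)) = 0
  rw [potentialCoeff_eq, Algebra.algebraMap_eq_smul_one, MultilinearMap.map_update_smul,
    A.isAInfinity.unit_zero _ (by lia) _ _ (Function.update_self _ _ _), smul_zero]

/-- The inner block consumes all the letters. The outer operation is then μ^2(a, c · 1) = c a, the
only place where a unit input survives. -/
theorem sum_insertionTerm_full (k : ℕ) (m : Fin n →₀ ℕ) (a : ExteriorAlgebra R₀ V) :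
    ∑ w ∈ wordsOf k m, insertionTerm A.μ (k + 1) k 0 (wordSeq b w a) =
      ExteriorAlgebra.algebraMapInv (potentialCoeff b A.μ k m) • a := by
  have key : ∀ w : Fin k → Fin n, insertionTerm A.μ (k + 1) k 0 (wordSeq b w a) =
      A.μ 2 (Function.update ![1, a] 0 (A.μ k fun s => ExteriorAlgebra.ι R₀ (b (w s)))) := by
    intro w
    rw [insertionTerm, show k + 1 - k + 1 = 2 by lia]
    congr 1
    funext t
    fin_cases t
    · simp [wordSeq_of_lt]
    · simp [wordSeq, add_comm 1 k]
  rw [Finset.sum_congr rfl fun w _ => key w, ← MultilinearMap.map_update_sum]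
  change A.μ 2 (Function.update _ _ (potentialCoeff b A.μ k m)) = _
  conv_lhs => rw [potentialCoeff_eq, Algebra.algebraMap_eq_smul_one, MultilinearMap.map_update_smul]
  congr 1
  have : Function.update ![1, a] 0 (1 : ExteriorAlgebra R₀ V) = ![1, a] := by
    funext t
    fin_cases t <;> simp
  rw [this, A.isAInfinity.unit_right]

theorem insertionSum_wordSeq (k q : ℕ) (w : Fin k → Fin n) {a : ExteriorAlgebra R₀ V}
    (ha : a ∈ ⋀[R₀]^q V) :
    ∑ j ∈ Finset.Icc 1 (k + 1), ∑ i ∈ Finset.range (k + 1 - j + 1),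
      insertionTerm A.μ (k + 1) j i (wordSeq b w a) = 0 := by
  rw [← A.isAInfinity.relations (k + 1) (fun t => if t < k then 1 else q) (wordSeq b w a)]
  · rw [insertionSum]
    refine Finset.sum_congr rfl fun j hj => Finset.sum_congr rfl fun i hi => ?_
    rw [Finset.mem_Icc] at hj
    rw [Finset.mem_range] at hi
    have : ∑ t ∈ Finset.range i, ((if t < k then 1 else q) + 1) = 2 * i := by
      rw [Finset.sum_congr rfl (g := fun _ => 2)]
      · simp [mul_comm]
      · intro t ht
        rw [Finset.mem_range] at ht
        rw [if_pos (by lia)]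
    -- Inputs to the right of the inner block are letters of degree 1, so the exponent is even and
    -- every sign is +1.
    rw [this, pow_mul]
    simp [insertionTerm]
  · intro t
    have := wordSeq_mem_G b w (mem_G_of_mem_degree (𝒜 := fun q : ℕ => ⋀[R₀]^q V) rfl ha) t
    split_ifs with h
    · simpa [h] using this
    · simpa [h] using this

theorem sum_Icc_one_eq {M : Type*} [AddCommMonoid M] (k : ℕ) (f : ℕ → M) :
    ∑ j ∈ Finset.Icc 1 (k + 1), f j = ∑ l ∈ Finset.range (k + 1), f (l + 1) :=
  (Finset.sum_nbij' (fun l => l + 1) (fun j => j - 1) (by simp)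
    (fun j hj => by simp at hj ⊢; lia) (by simp) (fun j hj => by simp at hj ⊢; lia)
    fun _ _ => rfl).symm

/-- The coefficients of the identity `μ^1_{0,v} ∘ μ^1_{0,v} = -𝔓`. -/
theorem insertCoeff_insertCoeff (m : Fin n →₀ ℕ) {q : ℕ} {a : ExteriorAlgebra R₀ V}
    (ha : a ∈ ⋀[R₀]^q V) :
    ∑ p ∈ Finset.HasAntidiagonal.antidiagonal m,
      insertCoeff b A.μ p.1.degree p.1 (insertCoeff b A.μ p.2.degree p.2 a) =
    -(MvPowerSeries.coeff m (discPotential b A) • a) := by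
  set k := m.degree with hk
  have h := Finset.sum_eq_zero fun w (_ : w ∈ wordsOf k m) => insertionSum_wordSeq b A k q w ha
  rw [Finset.sum_comm, Finset.sum_congr rfl fun j _ => Finset.sum_comm] at h
  -- The last value i = k + 1 - j is split off: there the inner block contains a, for smaller i it
  -- does not.
  simp only [Finset.sum_range_succ, Finset.sum_add_distrib] at h
  have h1 : ∑ j ∈ Finset.Icc 1 (k + 1), ∑ i ∈ Finset.range (k + 1 - j),
      ∑ w ∈ wordsOf k m, insertionTerm A.μ (k + 1) j i (wordSeq b w a) =
      MvPowerSeries.coeff m (discPotential b A) • a := by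
    rw [coeff_discPotential, ← hk]
    have : ∀ j ∈ Finset.Icc 1 (k + 1), ∑ i ∈ Finset.range (k + 1 - j),
        ∑ w ∈ wordsOf k m, insertionTerm A.μ (k + 1) j i (wordSeq b w a) =
        if j = k then ExteriorAlgebra.algebraMapInv (potentialCoeff b A.μ k m) • a else 0 := by
      intro j hj
      rw [Finset.mem_Icc] at hj
      split_ifs with hjk
      · subst hjk
        rw [Nat.add_sub_cancel_left, Finset.sum_range_one, sum_insertionTerm_full]
      · refine Finset.sum_eq_zero fun i hi => ?_
        rw [Finset.mem_range] at hi
        obtain ⟨l, hl⟩ : ∃ l, k = i + j + l := ⟨k - i - j, by lia⟩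
        rw [hl]
        exact sum_insertionTerm_middle b A hj.1 (by lia) m a
    rw [Finset.sum_congr rfl this, Finset.sum_ite_eq']
    split_ifs with h0
    · rfl
    -- The block length k is missing from the range 1, …, k + 1 only if k = 0, and then the
    -- potential coefficient vanishes because μ^0 = 0.
    · obtain h0 : k = 0 := by
        simp at h0
        lia
      rw [h0, potentialCoeff, A.isAInfinity.curvature]
      simp
  have h2 : ∑ j ∈ Finset.Icc 1 (k + 1),
      ∑ w ∈ wordsOf k m, insertionTerm A.μ (k + 1) j (k + 1 - j) (wordSeq b w a) =
      ∑ p ∈ Finset.HasAntidiagonal.antidiagonal m,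
        insertCoeff b A.μ p.1.degree p.1 (insertCoeff b A.μ p.2.degree p.2 a) := by
    rw [sum_Icc_one_eq]
    have : ∀ l ∈ Finset.range (k + 1),
        ∑ w ∈ wordsOf k m, insertionTerm A.μ (k + 1) (l + 1) (k + 1 - (l + 1)) (wordSeq b w a) =
        ∑ p ∈ Finset.HasAntidiagonal.antidiagonal m,
          insertCoeff b A.μ (k - l) p.1 (insertCoeff b A.μ l p.2 a) := by
      intro l hl
      rw [Finset.mem_range] at hl
      obtain ⟨i, hi⟩ : ∃ i, k = i + l := ⟨k - l, by lia⟩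
      rw [hi, show i + l + 1 - (l + 1) = i by lia, show i + l - l = i by lia]
      exact sum_insertionTerm_last b A.μ i l m a
    rw [Finset.sum_congr rfl this, Finset.sum_comm]
    refine Finset.sum_congr rfl fun p hp => ?_
    have hdeg : p.1.degree + p.2.degree = k := by
      rw [← map_add, Finset.HasAntidiagonal.mem_antidiagonal.1 hp]
    -- For a given factorisation of the monomial, only one position of the cut admits words.
    rw [Finset.sum_eq_single_of_mem p.2.degree (by simp; lia)]
    · rw [show k - p.2.degree = p.1.degree by lia]
    · intro l _ hl
      rw [insertCoeff_apply b A.μ l, wordsOf_eq_empty hl.symm, Finset.sum_empty, map_zero]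
  rw [h1, h2] at h
  exact eq_neg_of_add_eq_zero_right h

theorem coeffE_smul (m : Fin n →₀ ℕ) (r : FormalRing R₀ n) (y : ExtR R₀ V n) :
    coeffE m (r • y) = ∑ p ∈ Finset.HasAntidiagonal.antidiagonal m,
      MvPowerSeries.coeff p.2 r • coeffE p.1 y := by
  classical
  induction y using TensorProduct.induction_on with
  | zero => simp
  | add x y hx hy => simp only [smul_add, map_add, hx, hy, Finset.sum_add_distrib]
  | tmul c a =>
    rw [TensorProduct.smul_tmul', coeffE_tmul, smul_eq_mul, mul_comm, MvPowerSeries.coeff_mul,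
      Finset.sum_smul]
    refine Finset.sum_congr rfl fun p _ => ?_
    rw [coeffE_tmul, smul_smul, mul_comm]

theorem insertV_tmul (r : FormalRing R₀ n) (a : ExteriorAlgebra R₀ V) :
    insertV b A (r ⊗ₜ a) =
      r • ofCoeffs b fun m => insertCoeff b A.μ m.degree m a :=
  LinearMap.liftBaseChange_tmul _ _ _ _

theorem coeffE_insertV (m : Fin n →₀ ℕ) (y : ExtR R₀ V n) :
    coeffE m (insertV b A y) = ∑ p ∈ Finset.HasAntidiagonal.antidiagonal m,
      insertCoeff b A.μ p.1.degree p.1 (coeffE p.2 y) := by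
  induction y using TensorProduct.induction_on with
  | zero => simp
  | add x y hx hy => simp only [map_add, hx, hy, Finset.sum_add_distrib]
  | tmul r a =>
    rw [insertV_tmul, coeffE_smul]
    refine Finset.sum_congr rfl fun p _ => ?_
    rw [coeffE_ofCoeffs, coeffE_tmul, map_smul]

theorem coeffE_insertV_one_tmul (m : Fin n →₀ ℕ) (a : ExteriorAlgebra R₀ V) :
    coeffE m (insertV b A (1 ⊗ₜ a)) = insertCoeff b A.μ m.degree m a := by
  rw [insertV_tmul, one_smul, coeffE_ofCoeffs]

theorem insertV_insertV (y : ExtR R₀ V n) :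
    insertV b A (insertV b A y) = -(discPotential b A • y) := by
  have : insertV b A ∘ₗ insertV b A = -(discPotential b A • LinearMap.id) := by
    refine (extRBasis b).ext fun s => extR_ext b fun m => ?_
    rw [Module.Basis.baseChange_apply, LinearMap.comp_apply, coeffE_insertV]
    simp only [coeffE_insertV_one_tmul]
    rw [insertCoeff_insertCoeff b A m (basis_mem_degree b s)]
    rw [LinearMap.neg_apply, LinearMap.smul_apply, LinearMap.id_apply, map_neg,
      TensorProduct.smul_tmul', coeffE_tmul, smul_eq_mul, mul_one]
  exact LinearMap.congr_fun this y

end Exterior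

end SuperMF

/-! ### The mirror matrix factorisation and its leading term. -/

namespace SuperMF

open Superfiltration

section Generic

variable {R X : Type*} [CommRing R] [AddCommGroup X] [Module R X] {S : Superfiltration R X}

theorem comp_sign_mem_G {f : X →ₗ[R] X} {i : ZMod 2} (hf : f ∈ (S.hom S).G i) :
    f ∘ₗ S.sign ∈ (S.hom S).G i := comp_mem_G (by simp) hf S.sign_mem_G

/-- An odd map anticommutes with the parity sign, which turns the square -P into P. -/
theorem comp_sign_comp_self {f : X →ₗ[R] X} (hf : f ∈ (S.hom S).G 1) {P : R}
    (h : ∀ x, f (f x) = -(P • x)) : (f ∘ₗ S.sign) ∘ₗ (f ∘ₗ S.sign) = P • LinearMap.id := by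
  ext x
  rw [LinearMap.comp_apply, LinearMap.comp_apply, LinearMap.comp_apply, sign_odd_apply hf,
    sign_sign, map_neg, h, neg_neg]
  rfl

theorem mem_F_neg_one_of_odd {f : X →ₗ[R] X} (hF : f ∈ (S.hom S).F 0) (hG : f ∈ (S.hom S).G 1) :
    f ∈ (S.hom S).F (-1) := by
  refine mem_F_of_mem_G _ (by simpa using hF) ?_
  have : ((-1 : ℤ) : ZMod 2) = 1 := rfl
  rwa [this]

theorem eq_neg_add_add (f g : X →ₗ[R] X) : f = -g + (f + g) := by abel

theorem isSuperfiltered_one_of_add {f g : X →ₗ[R] X} (hG : f ∈ (S.hom S).G 1)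
    (hg : g ∈ (S.hom S).F 1) (hfg : f + g ∈ (S.hom S).F 0) : S.IsSuperfiltered S 1 f := by
  refine ⟨by rwa [Int.cast_one], ?_⟩
  rw [eq_neg_add_add f g]
  exact add_mem (neg_mem hg) ((S.hom S).mono (by lia) hfg)

end Generic

section Exterior

variable {R₀ : Type u} [CommRing R₀] {V : Type v} [AddCommGroup V] [Module R₀ V] {n : ℕ}
  (b : Module.Basis (Fin n) R₀ V) (A : SuperfilteredDeformation R₀ V)

theorem insertV_mem_G : insertV b A ∈ (endSF R₀ V n).G 1 := fun j x hx => by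
  rw [mem_extRSF_G_iff b] at hx ⊢
  intro m
  rw [coeffE_insertV]
  refine sum_mem fun p _ => ?_
  have := insertCoeff_mem_G b A.isAInfinity.degree p.1.degree p.1
  rw [Int.cast_one] at this
  exact this _ _ (hx p.2)

theorem mirrorD_mem_G : mirrorD b A ∈ (endSF R₀ V n).G 1 := comp_sign_mem_G (insertV_mem_G b A)

theorem mirrorD_mul_self : mirrorD b A ∘ₗ mirrorD b A = discPotential b A • LinearMap.id :=
  comp_sign_comp_self (insertV_mem_G b A) (insertV_insertV b A)

/-- The operations of the formal `A_∞`-structure on the exterior algebra. -/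
noncomputable abbrev formalOps (R₀ : Type u) [CommRing R₀] (V : Type v) [AddCommGroup V]
    [Module R₀ V] : Ops R₀ (ExteriorAlgebra R₀ V) (ExteriorAlgebra R₀ V) :=
  dgOps (extSF R₀ V) (LinearMap.mul R₀ (ExteriorAlgebra R₀ V)) 0

theorem sum_wordsOf_one {M : Type*} [AddCommMonoid M] (m : Fin n →₀ ℕ) (f : Fin n → M) :
    ∑ w ∈ wordsOf 1 m, f (w 0) = ∑ i, if Finsupp.single i 1 = m then f i else 0 := by
  rw [wordsOf, Finset.sum_filter, ← (Equiv.funUnique (Fin 1) (Fin n)).symm.sum_comp]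
  simp

/-- Only μ^2(a, v) = -a ∧ v contributes. Moving v to the left produces (-1)^q, which the sign in the
mirror differential absorbs, leaving -v ∧ a. -/
theorem insertCoeff_formalOps (k : ℕ) (m : Fin n →₀ ℕ) {q : ℕ} {a : ExteriorAlgebra R₀ V}
    (ha : a ∈ ⋀[R₀]^q V) : (-1 : ℤ) ^ q • insertCoeff b (formalOps R₀ V) k m a =
      -if k = 1 then ∑ i, if Finsupp.single i 1 = m then ExteriorAlgebra.ι R₀ (b i) * a else 0
        else 0 := by
  rw [insertCoeff_apply]
  match k with
  | 0 =>
    have : ∀ w : Fin 0 → Fin n, formalOps R₀ V (0 + 1) (fun t => wordSeq b w a t) = 0 :=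
      fun w => rfl
    rw [Finset.sum_congr rfl fun w _ => this w, Finset.sum_const_zero, smul_zero,
      if_neg zero_ne_one, neg_zero]
  | 1 =>
    have : ∀ w : Fin 1 → Fin n, formalOps R₀ V (1 + 1) (fun t => wordSeq b w a t) =
        -((-1 : ℤ) ^ q • (ExteriorAlgebra.ι R₀ (b (w 0)) * a)) := fun w => by
      change a * (extSF R₀ V).sign (ExteriorAlgebra.ι R₀ (b (w 0))) = _
      rw [sign_odd _ (ι_mem_G _), mul_neg, mul_ι_of_mem_degree _ ha]
    rw [Finset.sum_congr rfl fun w _ => this w, Finset.sum_neg_distrib, ← Finset.smul_sum,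
      smul_neg, smul_smul, ← mul_pow, neg_mul_neg, one_mul, one_pow, one_smul,
      sum_wordsOf_one m fun i => ExteriorAlgebra.ι R₀ (b i) * a, if_pos rfl]
  | k + 2 =>
    have : ∀ w : Fin (k + 2) → Fin n, formalOps R₀ V (k + 2 + 1) (fun t => wordSeq b w a t) = 0 :=
      fun w => rfl
    rw [Finset.sum_congr rfl fun w _ => this w, Finset.sum_const_zero, smul_zero,
      if_neg (by lia), neg_zero]

theorem coeffE_koszulV_one_tmul (m : Fin n →₀ ℕ) (a : ExteriorAlgebra R₀ V) :
    coeffE m (koszulV b (1 ⊗ₜ a)) =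
      ∑ i, if Finsupp.single i 1 = m then ExteriorAlgebra.ι R₀ (b i) * a else 0 := by
  classical
  rw [koszulV, LinearMap.sum_apply, map_sum]
  refine Finset.sum_congr rfl fun i _ => ?_
  rw [LinearMap.smul_apply, extend_tmul, TensorProduct.smul_tmul', coeffE_tmul, smul_eq_mul,
    mul_one, MvPowerSeries.coeff_X]
  simp only [eq_comm (a := m)]
  split_ifs
  · rw [one_smul]
    rfl
  · rw [zero_smul]

theorem sign_tmul_of_mem_degree (b : Module.Basis (Fin n) R₀ V) {q : ℕ} {a : ExteriorAlgebra R₀ V} (ha : a ∈ ⋀[R₀]^q V)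
    (r : FormalRing R₀ n) :
    (extRSF R₀ V n).sign (r ⊗ₜ a) = (-1 : ℤ) ^ q • (r ⊗ₜ[R₀] a) :=
  sign_of_mem _ (tmul_mem_extRSF_G b r
    (mem_G_of_mem_degree (𝒜 := fun q : ℕ => ⋀[R₀]^q V) rfl ha))

theorem coeffE_mirrorD_add_koszulV (m : Fin n →₀ ℕ) {q : ℕ} {a : ExteriorAlgebra R₀ V}
    (ha : a ∈ ⋀[R₀]^q V) : coeffE m (mirrorD b A (1 ⊗ₜ a) + koszulV b (1 ⊗ₜ a)) =
      (-1 : ℤ) ^ q • insertCoeff b (fun k => A.μ k - formalOps R₀ V k) m.degree m a := by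
  have h1 : coeffE m (mirrorD b A (1 ⊗ₜ a)) =
      (-1 : ℤ) ^ q • insertCoeff b A.μ m.degree m a := by
    rw [mirrorD, LinearMap.comp_apply, sign_tmul_of_mem_degree b ha, map_zsmul, map_zsmul,
      coeffE_insertV_one_tmul]
  have h2 : coeffE m (koszulV b (1 ⊗ₜ a)) =
      -((-1 : ℤ) ^ q • insertCoeff b (formalOps R₀ V) m.degree m a) := by
    rw [insertCoeff_formalOps b _ m ha, neg_neg, coeffE_koszulV_one_tmul]
    split_ifs with h
    · rfl
    · refine Finset.sum_eq_zero fun i _ => if_neg ?_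
      rintro rfl
      simp at h
  have h3 : insertCoeff b (fun k => A.μ k - formalOps R₀ V k) m.degree m a =
      insertCoeff b A.μ m.degree m a - insertCoeff b (formalOps R₀ V) m.degree m a := by
    simp only [insertCoeff_apply, sub_apply, Finset.sum_sub_distrib]
  rw [map_add, h1, h2, h3, smul_sub, sub_eq_add_neg]

theorem mirrorD_add_koszulV_mem_F : mirrorD b A + koszulV b ∈ (endSF R₀ V n).F 0 := by
  intro p x hx
  refine mem_of_forall_basis_F (fun p x => mem_extRSF_F b) hx fun s hs => ?_
  rw [mem_extRSF_F_iff b]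
  intro m
  rw [Module.Basis.baseChange_apply, LinearMap.add_apply,
    coeffE_mirrorD_add_koszulV b A m (basis_mem_degree b s)]
  refine zsmul_mem ?_ _
  exact insertCoeff_mem_F b A.leading m.degree m p _
    ((extSF R₀ V).mono hs (basis_mem_extSF_F b s))

theorem mirrorD_add_koszulV_mem_G : mirrorD b A + koszulV b ∈ (endSF R₀ V n).G 1 :=
  Submodule.add_mem _ (mirrorD_mem_G b A) (koszulV_mem_G b)

/-- The leading-term condition gives only degree 0; oddness gains the extra degree that the lifting
argument needs. -/
theorem mirrorD_add_koszulV_mem_F_neg_one :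
    mirrorD b A + koszulV b ∈ (endSF R₀ V n).F (-1) :=
  mem_F_neg_one_of_odd (mirrorD_add_koszulV_mem_F b A) (mirrorD_add_koszulV_mem_G b A)

theorem mirrorD_eq : mirrorD b A = -koszulV b + (mirrorD b A + koszulV b) :=
  eq_neg_add_add _ _

theorem mirrorD_isFilteredMF :
    IsFilteredMF (extRSF R₀ V n) (discPotential b A) (mirrorD b A) where
  free := Module.Free.of_basis (extRBasis b)
  finite := Module.Finite.of_basis (extRBasis b)
  superfiltered := isSuperfiltered_one_of_add (mirrorD_mem_G b A) (koszulV_mem_F b)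
    (mirrorD_add_koszulV_mem_F b A)
  square := mirrorD_mul_self b A

theorem exists_mirror_closed_lift {w : Fin n → FormalRing R₀ n}
    (hw : ∑ i, MvPowerSeries.X i * w i = discPotential b A) :
    ∃ i : ExtR R₀ V n →ₗ[FormalRing R₀ n] ExtR R₀ V n, i ∈ (endSF R₀ V n).G 0 ∧
      i - LinearMap.id ∈ (endSF R₀ V n).F (-2) ∧ koszulD b w ∘ₗ i = i ∘ₗ mirrorD b A := by
  obtain ⟨H, hH, hKH⟩ := exists_koszul_homotopy b
  have hd := mirrorD_mul_self b A
  have hd' := (koszulD_isFilteredMF b hw).square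
  rw [mirrorD_eq] at hd ⊢
  rw [koszulD_eq] at hd' ⊢
  exact exists_closed_lift (B := extRBasis b) (H := H.toAddMonoidHom)
    (fun p x => mem_extRSF_F b) (fun i x => mem_extRSF_G b) (extRSF_F_top b) (extRSF_F_bot b)
    hH.1 hH.2 (koszulV_mem_F b) (koszulW_mem_F b w) (mirrorD_add_koszulV_mem_F_neg_one b A)
    (koszulV_mem_G b) (koszulW_mem_G b w) (mirrorD_add_koszulV_mem_G b A)
    (fun x hx => by rw [koszulV_apply, koszulV_apply]; exact hKH x hx) hd' hd

end Exterior

end SuperMF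

/-! ### Strict A∞-homomorphisms and conjugation of endomorphism algebras. -/

namespace SuperMF

open Superfiltration

section UnaryOps

variable {R X Y : Type*} [CommRing R] [AddCommGroup X] [Module R X] [AddCommGroup Y] [Module R Y]

theorem unaryOps_of_eq_one (f : X →ₗ[R] Y) {k : ℕ} (hk : k = 1) (a : Fin k → X) :
    unaryOps f k a = f (a ⟨0, by lia⟩) := by
  subst hk
  rfl

theorem unaryOps_of_ne_one (f : X →ₗ[R] Y) {k : ℕ} (hk : k ≠ 1) : unaryOps f k = 0 := by
  match k with
  | 0 => rfl
  | 1 => exact absurd rfl hk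
  | k + 2 => rfl

/-- Any composition other than 1 + … + 1 has a block on which the homomorphism component is zero. -/
theorem compositionSum_unaryOps (μ : Ops R Y Y) (f : X →ₗ[R] Y) (k : ℕ) (a : ℕ → X) :
    compositionSum μ (unaryOps f) k a = μ k (fun t => f (a t)) := by
  rw [compositionSum, Finset.sum_eq_single_of_mem (Composition.ones k) (Finset.mem_univ _)]
  · have : ∀ r : Fin (Composition.ones k).length,
        unaryOps f ((Composition.ones k).blocksFun r)
          (fun s => a ((Composition.ones k).embedding r s)) = f (a r) := fun r => by
      rw [unaryOps_of_eq_one f (Composition.ones_blocksFun k r), Composition.ones_embedding]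
    simp only [this]
    rw [Composition.ones_length]
  · intro c _ hc
    obtain ⟨r, hr⟩ : ∃ r, c.blocksFun r ≠ 1 := by
      by_contra! h
      refine hc (Composition.eq_ones_iff.2 fun i hi => ?_)
      rw [← Composition.ofFn_blocksFun, List.mem_ofFn] at hi
      obtain ⟨r, rfl⟩ := hi
      exact h r
    refine MultilinearMap.map_coord_zero _ r ?_
    rw [unaryOps_of_ne_one f hr]
    rfl

/-- Only the insertion of all k inputs leaves an outer operation of arity one. For k = 0 the sum is
empty, which is why μ^0 must vanish. -/
theorem insertionSum_unaryOps (μ : Ops R X X) (h0 : μ 0 = 0) (f : X →ₗ[R] Y) (k : ℕ) (d : ℕ → ℕ)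
    (a : ℕ → X) : insertionSum μ (unaryOps f) k d a = f (μ k (fun t => a t)) := by
  rw [insertionSum]
  rcases Nat.eq_zero_or_pos k with rfl | hk
  · simp [h0]
  rw [Finset.sum_eq_single_of_mem k (Finset.mem_Icc.2 ⟨hk, le_rfl⟩)]
  · rw [Nat.sub_self, zero_add, Finset.sum_range_one, unaryOps_of_eq_one f rfl]
    simp
  · intro j hj hjk
    rw [Finset.mem_Icc] at hj
    refine Finset.sum_eq_zero fun i _ => ?_
    rw [unaryOps_of_ne_one f (by lia), zero_apply, smul_zero]

/-- A homomorphism of unital dg-algebras, seen as an `A_∞`-homomorphism. -/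
theorem isAInfinityHom_unaryOps {S : Superfiltration R X} {S' : Superfiltration R Y}
    {mul : X →ₗ[R] X →ₗ[R] X} {mul' : Y →ₗ[R] Y →ₗ[R] Y} {d : X →ₗ[R] X} {d' : Y →ₗ[R] Y}
    {f : X →ₗ[R] Y} {e : X} {e' : Y} (hG : f ∈ (S.hom S').G 0) (hF : f ∈ (S.hom S').F 0)
    (hd : ∀ x, f (d x) = d' (f x)) (hmul : ∀ x y, f (mul x y) = mul' (f x) (f y))
    (he : f e = e') : IsAInfinityHom S S' (dgOps S mul d) (dgOps S' mul' d') e e' (unaryOps f) where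
  zero := rfl
  degree k p a ha := by
    by_cases hk : k = 1
    · subst hk
      simpa [unaryOps_of_eq_one] using hG _ _ (ha 0)
    · rw [unaryOps_of_ne_one f hk]
      exact zero_mem _
  filtered k p a ha := by
    by_cases hk : k = 1
    · subst hk
      simpa [unaryOps_of_eq_one] using hF _ _ (ha 0)
    · rw [unaryOps_of_ne_one f hk]
      exact zero_mem _
  -- Both sides collapse, so the relation says that f intertwines each operation. Since f is even,
  -- it commutes with the signs in μ^1 and μ^2.
  relations k p a _ := by
    rw [insertionSum_unaryOps _ rfl, compositionSum_unaryOps]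
    match k with
    | 0 => exact map_zero f
    | 1 =>
      change f (d (S.sign (a 0))) = d' (S'.sign (f (a 0)))
      rw [hd, sign_even_apply hG]
    | 2 =>
      change f (mul (a 1) (S.sign (a 0))) = mul' (f (a 1)) (S'.sign (f (a 0)))
      rw [hmul, sign_even_apply hG]
    | k + 3 => exact map_zero f
  unit := he
  unit_zero k hk a t _ := by
    rw [unaryOps_of_ne_one f hk]
    rfl

end UnaryOps

section Conjugation

variable {R X : Type*} [CommRing R] [AddCommGroup X] [Module R X] {S : Superfiltration R X}

theorem mem_F_zero_of_sub_id {f : X →ₗ[R] X} (hf : f - LinearMap.id ∈ (S.hom S).F (-1)) :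
    f ∈ (S.hom S).F 0 := by
  rw [← sub_add_cancel f LinearMap.id]
  exact add_mem ((S.hom S).mono (by lia) hf) S.id_mem_F

theorem homDiff_eq_zero {d d' f : X →ₗ[R] X} (hG : f ∈ (S.hom S).G 0) (h : d' ∘ₗ f = f ∘ₗ d) :
    homDiff S S d d' f = 0 := by
  rw [homDiff_of_mem S S d d' (i := 0) (by simpa using hG), pow_zero, one_smul, h, sub_self]

/-- Conjugation by an invertible endomorphism. -/
def conjEquiv (i : (Module.End R X)ˣ) : Module.End R X ≃ₐ[R] Module.End R X :=
  AlgEquiv.ofAlgHom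
    { toFun a := i.val * a * i⁻¹.val
      map_one' := by simp
      map_mul' a c := by simp [mul_assoc]
      map_zero' := by simp
      map_add' a c := by rw [mul_add, add_mul]
      commutes' r := by rw [← Algebra.commutes, mul_assoc, Units.mul_inv, mul_one] }
    { toFun a := i⁻¹.val * a * i.val
      map_one' := by simp
      map_mul' a c := by simp [mul_assoc]
      map_zero' := by simp
      map_add' a c := by rw [mul_add, add_mul]
      commutes' r := by rw [← Algebra.commutes, mul_assoc, Units.inv_mul, mul_one] }
    (by ext1 a; simp [mul_assoc]) (by ext1 a; simp [mul_assoc])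

theorem conj_mem_G {i j : Module.End R X} (hi : i ∈ (S.hom S).G 0) (hj : j ∈ (S.hom S).G 0)
    {p : ZMod 2} {a : Module.End R X} (ha : a ∈ (S.hom S).G p) : i * a * j ∈ (S.hom S).G p :=
  comp_mem_G (i := p) (j := 0) (by simp) (comp_mem_G (i := 0) (j := p) (by simp) hi ha) hj

theorem conj_mem_F {i j : Module.End R X} (hi : i ∈ (S.hom S).F 0) (hj : j ∈ (S.hom S).F 0)
    {p : ℤ} {a : Module.End R X} (ha : a ∈ (S.hom S).F p) : i * a * j ∈ (S.hom S).F p :=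
  comp_mem_F (p := p) (q := 0) (by simp) (comp_mem_F (p := 0) (q := p) (by simp) hi ha) hj

theorem conj_sub_mem_F {i j : Module.End R X} (hi : i - LinearMap.id ∈ (S.hom S).F (-1))
    (hj : j - LinearMap.id ∈ (S.hom S).F (-1)) {p : ℤ} {a : Module.End R X}
    (ha : a ∈ (S.hom S).F p) : i * a * j - a ∈ (S.hom S).F (p + -1) := by
  have h : i * a * j - a = (i - LinearMap.id) ∘ₗ (a ∘ₗ j) + a ∘ₗ (j - LinearMap.id) := by
    ext x
    simp
  rw [h]
  exact add_mem (comp_mem_F (p := -1) (q := p) (by lia) hi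
      (comp_mem_F (p := p) (q := 0) (by lia) ha (mem_F_zero_of_sub_id hj)))
    (comp_mem_F (p := p) (q := -1) (by lia) ha hj)

theorem conj_homDiff {d d' i j : Module.End R X} (hi : i ∈ (S.hom S).G 0)
    (hj : j ∈ (S.hom S).G 0) (hid : d' * i = i * d) (hjd : d * j = j * d')
    (a : Module.End R X) : i * homDiff S S d d a * j = homDiff S S d' d' (i * a * j) := by
  -- Conjugation is itself an even map on the endomorphism algebra, so it commutes with the sign of
  -- a.
  have hsign : (S.hom S).sign (i * a * j) = i * (S.hom S).sign a * j :=
    sign_even_apply (S := S.hom S) (S' := S.hom S)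
      (f := LinearMap.mulRight R j ∘ₗ LinearMap.mulLeft R i)
      (fun p x hx => by rw [add_zero]; exact conj_mem_G hi hj hx) a
  change i * (d * a - (S.hom S).sign a * d) * j =
    d' * (i * a * j) - (S.hom S).sign (i * a * j) * d'
  rw [hsign, mul_sub, sub_mul, ← mul_assoc i d, ← hid, mul_assoc i, mul_assoc _ d, hjd]
  simp only [mul_assoc]

/-- A closed automorphism which is the identity up to lower order terms induces an isomorphism of
endomorphism dg-algebras. -/
theorem exists_conj_isomorphism {n : ℕ} (hn : S.F n = ⊤) (hbot : S.F (-1) = ⊥)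
    {d d' i : Module.End R X} (hiG : i ∈ (S.hom S).G 0)
    (hiF : i - LinearMap.id ∈ (S.hom S).F (-2)) (hid : d' ∘ₗ i = i ∘ₗ d) :
    ∃ i : (Module.End R X)ˣ,
      (S.IsSuperfiltered S 0 i.val ∧ homDiff S S d d' i.val = 0 ∧
        S.SameLeadingTerm S 0 i.val LinearMap.id) ∧
      (S.IsSuperfiltered S 0 i⁻¹.val ∧ homDiff S S d' d i⁻¹.val = 0 ∧
        S.SameLeadingTerm S 0 i⁻¹.val LinearMap.id) ∧
      ∃ ψ : Module.End R X ≃ₐ[R] Module.End R X,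
        (∀ a, ψ a = i.val * a * i⁻¹.val) ∧
        (∀ a, ψ (homDiff S S d d a) = homDiff S S d' d' (ψ a)) ∧
        (S.hom S).IsSuperfiltered (S.hom S) 0 ψ.toLinearMap ∧
        (S.hom S).IsSuperfiltered (S.hom S) 0 ψ.symm.toLinearMap ∧
        (S.hom S).SameLeadingTerm (S.hom S) 0 ψ.toLinearMap LinearMap.id ∧
        IsAInfinityHom (S.hom S) (S.hom S) (endOps S d) (endOps S d') 1 1
          (unaryOps ψ.toLinearMap) := by
  have hi1 : i - LinearMap.id ∈ (S.hom S).F (-1) := (S.hom S).mono (by lia) hiF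
  obtain ⟨j, hjG, hjF, hij, hji⟩ := exists_unipotent_inverse hn hbot hiG hi1
  have hi0 := mem_F_zero_of_sub_id hi1
  have hj0 := mem_F_zero_of_sub_id hjF
  have hid' : d' * i = i * d := hid
  have hjd : d * j = j * d' := by
    rw [← one_mul (d * j), ← hji, mul_assoc j, ← mul_assoc i, ← hid', mul_assoc d', hij, mul_one]
  have hcG : (conjEquiv ⟨i, j, hij, hji⟩).toLinearMap ∈ ((S.hom S).hom (S.hom S)).G 0 :=
    fun p a ha => by rw [add_zero]; exact conj_mem_G hiG hjG ha
  have hcF : (conjEquiv ⟨i, j, hij, hji⟩).toLinearMap ∈ ((S.hom S).hom (S.hom S)).F 0 :=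
    fun p a ha => by rw [add_zero]; exact conj_mem_F hi0 hj0 ha
  refine ⟨⟨i, j, hij, hji⟩,
    ⟨⟨by rw [Int.cast_zero]; exact hiG, hi0⟩, homDiff_eq_zero hiG hid, hi1⟩,
    ⟨⟨by rw [Int.cast_zero]; exact hjG, hj0⟩, homDiff_eq_zero hjG hjd, hjF⟩,
    conjEquiv ⟨i, j, hij, hji⟩, fun _ => rfl, conj_homDiff hiG hjG hid' hjd,
    ⟨by rw [Int.cast_zero]; exact hcG, hcF⟩, ⟨?_, ?_⟩, fun p a ha => conj_sub_mem_F hi1 hjF ha,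
    isAInfinityHom_unaryOps hcG hcF (conj_homDiff hiG hjG hid' hjd)
      (fun x y => map_mul (conjEquiv ⟨i, j, hij, hji⟩) x y)
      (map_one (conjEquiv ⟨i, j, hij, hji⟩))⟩
  · rw [Int.cast_zero]
    exact fun p a ha => by rw [add_zero]; exact conj_mem_G hjG hiG ha
  · exact fun p a ha => by rw [add_zero]; exact conj_mem_F hj0 hi0 ha

end Conjugation

end SuperMF

theorem mainTheorem8 {R₀ : Type u} [CommRing R₀] {V : Type v} [AddCommGroup V] [Module R₀ V]
    {n : ℕ} (b : Module.Basis (Fin n) R₀ V) (A : SuperfilteredDeformation R₀ V)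
    (w : Fin n → FormalRing R₀ n) (hw : IsLift (discPotential b A) w) :
    IsFilteredMF (extRSF R₀ V n) (discPotential b A) (mirrorD b A) ∧
    IsFilteredMF (extRSF R₀ V n) (discPotential b A) (koszulD b w) ∧
    ∃ i : (Module.End (FormalRing R₀ n) (ExtR R₀ V n))ˣ,
      -- `i` is a cocycle from `𝓔` to `𝓔₀` of degree `0`, with leading term the identity
      ((extRSF R₀ V n).IsSuperfiltered (extRSF R₀ V n) 0 i.val ∧
        homDiff (extRSF R₀ V n) (extRSF R₀ V n) (mirrorD b A) (koszulD b w) i.val = 0 ∧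
        (extRSF R₀ V n).SameLeadingTerm (extRSF R₀ V n) 0 i.val LinearMap.id) ∧
      -- and so is its inverse, from `𝓔₀` to `𝓔`
      ((extRSF R₀ V n).IsSuperfiltered (extRSF R₀ V n) 0 i⁻¹.val ∧
        homDiff (extRSF R₀ V n) (extRSF R₀ V n) (koszulD b w) (mirrorD b A) i⁻¹.val = 0 ∧
        (extRSF R₀ V n).SameLeadingTerm (extRSF R₀ V n) 0 i⁻¹.val LinearMap.id) ∧
      -- conjugation by `i` is an isomorphism of unital algebras
      ∃ ψ : Module.End (FormalRing R₀ n) (ExtR R₀ V n) ≃ₐ[FormalRing R₀ n]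
          Module.End (FormalRing R₀ n) (ExtR R₀ V n),
        (∀ a, ψ a = i.val * a * i⁻¹.val) ∧
        -- which commutes with the differentials,
        (∀ a, ψ (homDiff (extRSF R₀ V n) (extRSF R₀ V n) (mirrorD b A) (mirrorD b A) a) =
          homDiff (extRSF R₀ V n) (extRSF R₀ V n) (koszulD b w) (koszulD b w) (ψ a)) ∧
        -- is superfiltered of degree `0`, as is its inverse,
        (endSF R₀ V n).IsSuperfiltered (endSF R₀ V n) 0 ψ.toLinearMap ∧
        (endSF R₀ V n).IsSuperfiltered (endSF R₀ V n) 0 ψ.symm.toLinearMap ∧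
        -- agrees with the identity up to lower order terms,
        (endSF R₀ V n).SameLeadingTerm (endSF R₀ V n) 0 ψ.toLinearMap LinearMap.id ∧
        -- and is the first term of a strictly unital `A_∞`-homomorphism with no higher terms
        IsAInfinityHom (endSF R₀ V n) (endSF R₀ V n)
          (endOps (extRSF R₀ V n) (mirrorD b A)) (endOps (extRSF R₀ V n) (koszulD b w))
          1 1 (unaryOps ψ.toLinearMap) := by
  obtain ⟨i, hiG, hiF, hid⟩ := exists_mirror_closed_lift b A hw.2
  exact ⟨mirrorD_isFilteredMF b A, koszulD_isFilteredMF b hw.2,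
    exists_conj_isomorphism (extRSF_F_top b) (extRSF_F_bot b) hiG hiF hid⟩
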